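/- Let $m\ge 2$ and let $0=b_0<b_1<\dots<b_m=1$ be a partition of $[0,1]$; put $l_i:=b_{i+1}-b_i$ for $0\le i\le m-1$. Let $\mathcal I_n:=\{0,\dots,m-1\}^n$ and let $\mathcal I^*:=\bigcup_{n\ge 0}\mathcal I_n$ be the set of finite words, including the empty word $\varnothing$. On a probability space $(\Theta,\mathscr F,\mathbb P)$ let $\mathbf Y_\omega=(y_{\omega1},\dots,y_{\omega(m-1)})$, $\omega\in\mathcal I^*$, be independent, identically distributed random vectors with values in $[0,1]^{m-1}$ almost surely (for fixed $\omega$ the coordinates need not be independent); write $\mathbf Y_\varnothing=(y_1,\dots,y_{m-1})$ and assume $\mathbb P(y_i\in\{0,1\})=0$ for $1\le i\le m-1$. Set $y_{\omega0}:=0$ and $y_{\omega m}:=1$ for every $\omega\in\mathcal I^*$ (so $y_0=0$, $y_m=1$), and $a_i:=|y_{i+1}-y_i|$ for $0\le i\le m-1$. For $\omega\in\mathcal I^*$ and $0\le i\le m-1$ let $$T_{\omega i}(u,v):=\big((b_{i+1}-b_i)u+b_i,\ (y_{\omega(i+1)}-y_{\omega i})v+y_{\omega i}\big),$$ and for $\omega=\omega_1\cdots\omega_n\in\mathcal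 I_n$ let $R_\omega:=T_{\omega_1}\circ T_{\omega_1\omega_2}\circ\dots\circ T_{\omega_1\cdots\omega_n}([0,1]^2)$. Let $\Gamma:=\bigcap_{n}\bigcup_{\omega\in\mathcal I_n}R_\omega$. For a bounded set $E\subset\mathbb R^2$ and $\delta>0$ let $N_\delta(E)$ be the least number of closed axis-parallel squares of side length $\delta$ that cover $E$. The box-counting dimension of $E$ exists and equals $s$ if $\lim_{\delta\to0^+}\frac{\log N_\delta(E)}{-\log\delta}=s$. **Theorem.** The equation $$1=\mathbb E\Big(\sum_{i=0}^{m-1}a_i\,l_i^{\,s-1}\Big)$$ has a unique real solution $s$. Almost surely, $\Gamma$ is the graph of a continuous function $F:[0,1]\to[0,1]$ (the random self-affine function), and the box-counting dimension of the graph of $F$ exists and equals $s$. -/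

import Mathlib

open MeasureTheory ProbabilityTheory Filter Topology

namespace RandomSelfAffine

noncomputable section

/-- Closed axis-parallel square in the plane with lower left corner `a` and side length `δ`. -/
def square (a : ℝ × ℝ) (δ : ℝ) : Set (ℝ × ℝ) :=
  Set.Icc a.1 (a.1 + δ) ×ˢ Set.Icc a.2 (a.2 + δ)

/-- `N_δ(E)`: the least number of squares of side length `δ` in a cover of the (bounded) set `E`.
The squares of a cover are recorded by their lower left corners. -/
def coverNumber (δ : ℝ) (E : Set (ℝ × ℝ)) : ℕ :=
  sInf {k : ℕ | ∃ A : Finset (ℝ × ℝ), A.card = k ∧ E ⊆ ⋃ a ∈ A, square a δ}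

/-- The planar set `E` is bounded, its box-counting dimension exists (as a limit over all real
`δ → 0+`), and it equals `s`. -/
def HasBoxDim (E : Set (ℝ × ℝ)) (s : ℝ) : Prop :=
  Bornology.IsBounded E ∧
    Tendsto (fun δ : ℝ => Real.log (coverNumber δ E) / (-Real.log δ)) (𝓝[>] 0) (𝓝 s)

variable {m : ℕ}

/-- The length `l_i = b_{i+1} - b_i` of the `i`-th interval of the partition. -/
def len (b : Fin (m + 1) → ℝ) (i : Fin m) : ℝ := b i.succ - b i.castSucc

/-- The height ratio `a_i = |y_{i+1} - y_i|` belonging to `y = (y_0, …, y_m)`. -/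
def ratio (y : Fin (m + 1) → ℝ) (i : Fin m) : ℝ := |y i.succ - y i.castSucc|

/-- The affine map `(u, v) ↦ ((b_{i+1} - b_i) u + b_i, (y_{i+1} - y_i) v + y_i)`. -/
def affMap (b y : Fin (m + 1) → ℝ) (i : Fin m) (p : ℝ × ℝ) : ℝ × ℝ :=
  ((b i.succ - b i.castSucc) * p.1 + b i.castSucc,
    (y i.succ - y i.castSucc) * p.2 + y i.castSucc)

/-- For a family `y` of vectors `y ω = (y_{ω0}, …, y_{ωm})` indexed by the finite words `ω`, and
for a word `ω = ω_1 … ω_n`, the composition `T_{ω_1} ∘ T_{ω_1 ω_2} ∘ ⋯ ∘ T_{ω_1 … ω_n}`, where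
`T_{ωi} = affMap b (y ω) i`. The recursion passes to the subfamily `v ↦ y (i v)` of the vectors
attached to the descendants of the word `i`. -/
def affComp (b : Fin (m + 1) → ℝ) :
    (List (Fin m) → Fin (m + 1) → ℝ) → List (Fin m) → ℝ × ℝ → ℝ × ℝ
  | _, [] => id
  | y, i :: w => affMap b (y []) i ∘ affComp b (fun v => y (i :: v)) w

/-- The rectangle `R_ω`, the image of the unit square under `affComp b y ω`. -/
def rect (b : Fin (m + 1) → ℝ) (y : List (Fin m) → Fin (m + 1) → ℝ) (ω : List (Fin m)) :
    Set (ℝ × ℝ) :=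
  affComp b y ω '' (Set.Icc (0 : ℝ) 1 ×ˢ Set.Icc (0 : ℝ) 1)

/-- The set `Γ`, the intersection over `n` of the unions of all `R_ω` with `ω` of length `n`. -/
def limitSet (b : Fin (m + 1) → ℝ) (y : List (Fin m) → Fin (m + 1) → ℝ) : Set (ℝ × ℝ) :=
  ⋂ n : ℕ, ⋃ ω : List (Fin m), ⋃ _ : ω.length = n, rect b y ω

/-- The graph, as a subset of the plane, of a continuous function `[0,1] → [0,1]`. -/
def graph (F : C(unitInterval, unitInterval)) : Set (ℝ × ℝ) :=
  Set.range fun x : unitInterval => ((x : ℝ), (F x : ℝ))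

end

end RandomSelfAffine

/-! Put the weight `c_i = a_i l_i^(s-1)` on the edges of the word tree, so that the weights at a
vertex have expected sum one. For `δ > 0` stop each word as soon as its rectangle has width at most
`δ`; that width is then at least `r δ`, with `r` the least `l_i` and `δ ≤ 1`. Let `Z(δ)` be the sum
of the weight products over this stopping line. Up to constants, `Z(δ)` is `δ^(s-1)` times the total
height of the stopped rectangles.

Geometry shows that `δ^s N_δ` is comparable to `Z(δ)`, up to a bounded term in the upper bound. A
stopped rectangle of height `h` is covered by at most `h/δ + 1` squares, and there are at most `1/(r
δ)` such rectangles (`exists_cover_levelSet`, `casc_one_mul_le`). Conversely, the graph joins two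
opposite corners of each stopped rectangle, so at least `h/δ` squares of any cover meet the strip
above its base, and no square meets more than boundedly many strips (`mul_casc_le_card`).

Probability controls `Z`. Its mean is one, so along `δ = 2^(-k)` it almost surely grows more slowly
than any power (`ae_tendsto_rpow_mul_line`). Since `a_i < 1` almost surely, `∑ E c_i² < 1`. This
gives bounded variance and summable increments, hence a positive probability, uniform in the
starting level, that `Z` stays away from zero (`exists_prob_line_ge`). Almost surely two weights at
the root are positive, so the supremum `q < 1` of the failure probabilities satisfies `q ≤ q²`, and
`q = 0` (`ae_line_ge`).

For some `p`, `∑ E a_i^p < 1`, so the greatest height in a generation tends to zero almost surely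
and `Γ` is the graph of a continuous function (`exists_limitSet_eq_graph`). The equation for `s` has
a strictly decreasing continuous right-hand side, at least one at `s = 1` and at most one at `s = 2`
(`existsUnique_sum_rpow_eq_one`). -/

namespace RandomSelfAffine

/-! ### The random tree and its branching property -/

/-- The law of a family of independent random elements with law `μ`, indexed by the finite words
over `Fin m`. -/
noncomputable abbrev treeMeasure {E : Type*} [MeasurableSpace E] (m : ℕ) (μ : Measure E)
    [IsProbabilityMeasure μ] : Measure (List (Fin m) → E) :=
  Measure.infinitePi fun _ : List (Fin m) => μ

/-- Assemble a tree from its root value and the subtrees of its children. -/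
def joinTree {E : Type*} {m : ℕ} (p : E × (Fin m → List (Fin m) → E)) : List (Fin m) → E
  | [] => p.1
  | i :: v => p.2 i v

theorem measurable_joinTree {E : Type*} [MeasurableSpace E] {m : ℕ} :
    Measurable (joinTree : E × (Fin m → List (Fin m) → E) → List (Fin m) → E) := by
  refine measurable_pi_lambda _ fun w => ?_
  cases w with
  | nil => exact measurable_fst
  | cons i v => exact (measurable_pi_apply v).comp ((measurable_pi_apply i).comp measurable_snd)

theorem prod_words {m : ℕ} {M : Type*} [CommMonoid M] (s : Finset (List (Fin m)))
    (f : List (Fin m) → M) :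
    ∏ w ∈ s, f w = (if [] ∈ s then f [] else 1) *
      ∏ i : Fin m, ∏ v ∈ s.preimage (List.cons i) (List.cons_injective.injOn), f (i :: v) := by
  classical
  rw [← Finset.prod_fiberwise s List.head? f, Fintype.prod_option]
  congr 1
  · have : s.filter (fun w => w.head? = none) = if [] ∈ s then {[]} else ∅ := by
      ext w
      split_ifs with h
      · simp only [Finset.mem_filter, List.head?_eq_none_iff, Finset.mem_singleton]
        constructor
        · exact fun h => h.2
        · rintro rfl; exact ⟨h, rfl⟩
      · simp only [Finset.mem_filter, List.head?_eq_none_iff, Finset.notMem_empty, iff_false]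
        rintro ⟨h1, rfl⟩; exact h h1
    rw [this]
    split_ifs <;> simp
  · refine Finset.prod_congr rfl fun i _ => ?_
    symm
    refine Finset.prod_nbij (List.cons i) ?_ (List.cons_injective.injOn) ?_ (fun _ _ => rfl)
    · intro v hv
      simpa using hv
    · intro w hw
      simp only [Finset.coe_filter, Set.mem_ofPred_eq, List.head?_eq_some_iff] at hw
      obtain ⟨hw, v, rfl⟩ := hw
      exact ⟨v, by simpa using hw, rfl⟩

/-- The branching property: the root value and the subtrees of its children are independent, and
each subtree has the law of the whole tree. A product law is determined on finite cylinders, and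
grouping words by their first letter turns the preimage of a cylinder into a box. -/
theorem measurePreserving_joinTree {E : Type*} [MeasurableSpace E] {m : ℕ} (μ : Measure E)
    [IsProbabilityMeasure μ] :
    MeasurePreserving (joinTree : E × (Fin m → List (Fin m) → E) → List (Fin m) → E)
      (μ.prod (Measure.pi fun _ => treeMeasure m μ)) (treeMeasure m μ) := by
  classical
  refine ⟨measurable_joinTree, ?_⟩
  refine Measure.eq_infinitePi _ fun s t ht => ?_
  have hs : MeasurableSet ((s : Set (List (Fin m))).pi t) :=
    MeasurableSet.pi s.countable_toSet fun w _ => ht w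
  rw [Measure.map_apply measurable_joinTree hs, prod_words]
  have : joinTree ⁻¹' ((s : Set (List (Fin m))).pi t) =
      (if [] ∈ s then t [] else Set.univ) ×ˢ (Set.univ.pi fun i =>
        ((s.preimage (List.cons i) (List.cons_injective.injOn) : Finset _) :
          Set (List (Fin m))).pi fun v => t (i :: v)) := by
    ext p
    simp only [Set.mem_preimage, Set.mem_pi, Finset.mem_coe, Set.mem_prod, Set.mem_univ,
      true_implies, Finset.mem_preimage]
    constructor
    · intro h
      refine ⟨?_, fun i v hv => h _ hv⟩
      split_ifs with h0
      · exact h _ h0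
      · trivial
    · rintro ⟨h1, h2⟩ w hw
      cases w with
      | nil => rw [if_pos hw] at h1; exact h1
      | cons i v => exact h2 i v hw
  rw [this, Measure.prod_prod, Measure.pi_pi]
  congr 1
  · split_ifs <;> simp
  · exact Finset.prod_congr rfl fun i _ => Measure.infinitePi_pi _ fun v _ => ht _

/-! ### Weighted sums over stopping lines -/

/-- The total weight of the stopping line at level `x` (exploring at most `n` generations): a word
is not continued once the product of the `l i` along it is at most `x`. -/
noncomputable def casc {E : Type*} {m : ℕ} (c : Fin m → E → ℝ) (l : Fin m → ℝ) :
    ℕ → ℝ → (List (Fin m) → E) → ℝ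
  | 0, _, _ => 1
  -- Each child divides `x` by `l i`, so `1 ≤ x` means that the product of ratios so far is at most
  -- the initial level. At `x = 0` nothing stops and the sum runs over all words of length `n`.
  | n + 1, x, y => if 1 ≤ x then 1 else
      ∑ i, c i (y []) * casc c l n (x / l i) (fun v => y (i :: v))

section
variable {E : Type*} {m : ℕ} (c : Fin m → E → ℝ) (l : Fin m → ℝ)

@[simp] theorem casc_zero (x : ℝ) (y : List (Fin m) → E) : casc c l 0 x y = 1 := rfl

theorem casc_of_one_le {x : ℝ} (hx : 1 ≤ x) (n : ℕ) (y : List (Fin m) → E) :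
    casc c l n x y = 1 := by
  cases n with
  | zero => rfl
  | succ n => simp [casc, hx]

theorem casc_succ {x : ℝ} (hx : x < 1) (n : ℕ) (y : List (Fin m) → E) :
    casc c l (n + 1) x y = ∑ i, c i (y []) * casc c l n (x / l i) (fun v => y (i :: v)) := by
  simp [casc, not_le.2 hx]

theorem casc_nonneg (hc : ∀ i e, 0 ≤ c i e) (n : ℕ) (x : ℝ) (y : List (Fin m) → E) :
    0 ≤ casc c l n x y := by
  induction n generalizing x y with
  | zero => simp
  | succ n ih =>
    rcases le_or_gt 1 x with hx | hx
    · rw [casc_of_one_le c l hx]; exact zero_le_one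
    · rw [casc_succ c l hx]
      exact Finset.sum_nonneg fun i _ => mul_nonneg (hc _ _) (ih _ _)

/-- The fuel does not matter once it suffices to reach the stopping line. -/
theorem casc_fuel {L : ℝ} (hL0 : 0 < L) (hl0 : ∀ i, 0 < l i) (hl : ∀ i, l i ≤ L) {n n' : ℕ} {x : ℝ}
    (hn : L ^ n ≤ x) (hn' : L ^ n' ≤ x) (y : List (Fin m) → E) :
    casc c l n x y = casc c l n' x y := by
  induction n generalizing n' x y with
  | zero =>
    rw [pow_zero] at hn
    rw [casc_of_one_le c l hn, casc_of_one_le c l hn]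
  | succ n ih =>
    rcases le_or_gt 1 x with hx | hx
    · rw [casc_of_one_le c l hx, casc_of_one_le c l hx]
    · cases n' with
      | zero => rw [pow_zero] at hn'; linarith
      | succ n' =>
        rw [casc_succ c l hx, casc_succ c l hx]
        refine Finset.sum_congr rfl fun i _ => ?_
        have h : ∀ k : ℕ, L ^ (k + 1) ≤ x → L ^ k ≤ x / l i := fun k hk => by
          rw [le_div_iff₀ (hl0 i)]
          calc L ^ k * l i ≤ L ^ k * L := by gcongr; exact hl i
            _ ≤ x := by rwa [← pow_succ]
        rw [ih (h n hn) (h n' hn')]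

/-- A crude bound that serves integrability only. The base `m + 1` is at least one, which covers
words stopped early. -/
theorem casc_le (hc : ∀ i e, 0 ≤ c i e) (hc1 : ∀ i e, c i e ≤ 1) (n : ℕ) (x : ℝ)
    (y : List (Fin m) → E) : casc c l n x y ≤ ((m : ℝ) + 1) ^ n := by
  induction n generalizing x y with
  | zero => simp
  | succ n ih =>
    have h1 : (1 : ℝ) ≤ (m : ℝ) + 1 := by linarith [Nat.cast_nonneg (α := ℝ) m]
    rcases le_or_gt 1 x with hx | hx
    · rw [casc_of_one_le c l hx]; exact one_le_pow₀ h1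
    · rw [casc_succ c l hx]
      calc _ ≤ ∑ i : Fin m, ((m : ℝ) + 1) ^ n := by
            refine Finset.sum_le_sum fun i _ => ?_
            calc _ ≤ 1 * ((m : ℝ) + 1) ^ n :=
                  mul_le_mul (hc1 _ _) (ih _ _) (casc_nonneg c l hc _ _ _) zero_le_one
              _ = _ := one_mul _
        _ = m * ((m : ℝ) + 1) ^ n := by simp
        _ ≤ _ := by rw [pow_succ']; gcongr; linarith

theorem measurable_casc [MeasurableSpace E] (hc : ∀ i, Measurable (c i)) (n : ℕ) (x : ℝ) :
    Measurable (casc c l n x) := by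
  induction n generalizing x with
  | zero => exact measurable_const
  | succ n ih =>
    rcases le_or_gt 1 x with hx | hx
    · rw [funext (casc_of_one_le c l hx (n + 1))]; exact measurable_const
    · rw [funext (casc_succ c l hx n)]
      refine Finset.measurable_sum _ fun i _ => ?_
      exact ((hc i).comp (measurable_pi_apply _)).mul
        ((ih _).comp (measurable_pi_lambda _ fun v => measurable_pi_apply _))

end

/-! ### Moments computed by conditioning on the root -/

section
variable {E : Type*} [MeasurableSpace E] {m : ℕ} (μ : Measure E) [IsProbabilityMeasure μ]

theorem integrable_of_abs_le {α : Type*} [MeasurableSpace α] {ν : Measure α} [IsFiniteMeasure ν]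
    {f : α → ℝ} (hf : Measurable f) {K : ℝ} (h : ∀ a, |f a| ≤ K) : Integrable f ν :=
  Integrable.of_bound hf.aestronglyMeasurable K (ae_of_all _ h)

theorem integral_tree {f : (List (Fin m) → E) → ℝ} (hf : Measurable f) :
    ∫ y, f y ∂(treeMeasure m μ) =
      ∫ p, f (joinTree p) ∂(μ.prod (Measure.pi fun _ => treeMeasure m μ)) := by
  rw [← integral_map measurable_joinTree.aemeasurable hf.aestronglyMeasurable,
    (measurePreserving_joinTree (m := m) μ).map_eq]

theorem integral_pi_eval (i : Fin m) {f : (List (Fin m) → E) → ℝ} (hf : Measurable f) :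
    ∫ z : Fin m → List (Fin m) → E, f (z i) ∂(Measure.pi fun _ => treeMeasure m μ) =
      ∫ y, f y ∂(treeMeasure m μ) := by
  have h := (measurePreserving_eval (fun _ : Fin m => treeMeasure m μ) i).map_eq
  conv_rhs => rw [← h]
  rw [integral_map (measurable_pi_apply i).aemeasurable hf.aestronglyMeasurable]

/-- Each root weight is independent of the subtree it multiplies, so each expectation factors; the
weights at the root may depend on one another. -/
theorem integral_sum_mul_subtree {c : Fin m → E → ℝ} (hc : ∀ i, Measurable (c i))
    {K : ℝ} (hcK : ∀ i e, |c i e| ≤ K) {G : Fin m → (List (Fin m) → E) → ℝ}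
    (hG : ∀ i, Measurable (G i)) {B : ℝ} (hGB : ∀ i y, |G i y| ≤ B) :
    ∫ y, ∑ i, c i (y []) * G i (fun v => y (i :: v)) ∂(treeMeasure m μ) =
      ∑ i, (∫ e, c i e ∂μ) * ∫ y, G i y ∂(treeMeasure m μ) := by
  have hmeas : ∀ i, Measurable fun y : List (Fin m) → E => G i (fun v => y (i :: v)) := fun i =>
    (hG i).comp (measurable_pi_lambda _ fun v => measurable_pi_apply _)
  have hcm : ∀ i, Measurable fun y : List (Fin m) → E => c i (y []) := fun i =>
    (hc i).comp (measurable_pi_apply _)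
  rw [integral_finsetSum _ fun i _ => integrable_of_abs_le
    (f := fun y : List (Fin m) → E => c i (y []) * G i (fun v => y (i :: v))) ((hcm i).mul (hmeas i)) (K := K * B)
    fun y => by
      rw [abs_mul]
      exact mul_le_mul (hcK _ _) (hGB _ _) (abs_nonneg _) ((abs_nonneg _).trans (hcK i (y [])))]
  refine Finset.sum_congr rfl fun i _ => ?_
  rw [integral_tree μ (f := fun y => c i (y []) * G i (fun v => y (i :: v)))
    ((hcm i).mul (hmeas i))]
  simp only [joinTree]
  rw [integral_prod_mul (μ := μ) (ν := Measure.pi fun _ => treeMeasure m μ) (c i)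
    (fun z : Fin m → List (Fin m) → E => G i (z i)), integral_pi_eval μ i (hG i)]

/-- Expectation over a stopping line when the weights have total mean one. -/
theorem integral_casc {c : Fin m → E → ℝ} (l : Fin m → ℝ) (hc : ∀ i, Measurable (c i))
    (hc0 : ∀ i e, 0 ≤ c i e) (hc1 : ∀ i e, c i e ≤ 1) (hsum : ∑ i, ∫ e, c i e ∂μ = 1)
    (n : ℕ) (x : ℝ) : ∫ y, casc c l n x y ∂(treeMeasure m μ) = 1 := by
  induction n generalizing x with
  | zero => simp
  | succ n ih =>
    rcases le_or_gt 1 x with hx | hx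
    · simp [casc_of_one_le c l hx]
    · simp only [casc_succ c l hx]
      rw [integral_sum_mul_subtree μ hc (K := 1)
        (fun i e => by rw [abs_of_nonneg (hc0 i e)]; exact hc1 i e)
        (fun i => measurable_casc c l hc n _) (B := ((m : ℝ) + 1) ^ n)
        (fun i y => by rw [abs_of_nonneg (casc_nonneg c l hc0 _ _ _)]; exact casc_le c l hc0 hc1 _ _ _)]
      simp [ih, hsum]

/-- Expectation of the sum over a whole generation. -/
theorem integral_casc_level {c : Fin m → E → ℝ} (l : Fin m → ℝ) (hc : ∀ i, Measurable (c i))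
    (hc0 : ∀ i e, 0 ≤ c i e) (hc1 : ∀ i e, c i e ≤ 1) (n : ℕ) :
    ∫ y, casc c l n 0 y ∂(treeMeasure m μ) = (∑ i, ∫ e, c i e ∂μ) ^ n := by
  induction n with
  | zero => simp
  | succ n ih =>
    simp only [casc_succ c l zero_lt_one, zero_div]
    rw [integral_sum_mul_subtree μ hc (K := 1)
      (fun i e => by rw [abs_of_nonneg (hc0 i e)]; exact hc1 i e)
      (fun i => measurable_casc c l hc n _) (B := ((m : ℝ) + 1) ^ n)
      (fun i y => by rw [abs_of_nonneg (casc_nonneg c l hc0 _ _ _)]; exact casc_le c l hc0 hc1 _ _ _)]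
    rw [← Finset.sum_mul, ih, pow_succ']

/-- Orthogonality of the contributions of the subtrees. -/
theorem integral_sq_subtree {c : Fin m → E → ℝ} (hc : ∀ i, Measurable (c i))
    {K : ℝ} (hcK : ∀ i e, |c i e| ≤ K) {h : E → ℝ} (hh : Measurable h) (hhK : ∀ e, |h e| ≤ K)
    {G : Fin m → (List (Fin m) → E) → ℝ}
    (hG : ∀ i, Measurable (G i)) {B : ℝ} (hGB : ∀ i y, |G i y| ≤ B)
    (hG0 : ∀ i, ∫ y, G i y ∂(treeMeasure m μ) = 0) :
    ∫ y, (h (y []) + ∑ i, c i (y []) * G i (fun v => y (i :: v))) ^ 2 ∂(treeMeasure m μ) =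
      ∫ e, h e ^ 2 ∂μ +
        ∑ i, (∫ e, c i e ^ 2 ∂μ) * ∫ y, G i y ^ 2 ∂(treeMeasure m μ) := by
  obtain ⟨e0⟩ : Nonempty E := nonempty_of_isProbabilityMeasure μ
  have hK : 0 ≤ K := (abs_nonneg _).trans (hhK e0)
  set M := treeMeasure m μ
  have hGm : ∀ i, Measurable fun z : Fin m → List (Fin m) → E => G i (z i) := fun i =>
    (hG i).comp (measurable_pi_apply i)
  have hGmem : ∀ (i : Fin m) (a : ℝ), MemLp (fun z : Fin m → List (Fin m) → E => a * G i (z i)) 2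
      (Measure.pi fun _ => M) := fun i a =>
    (MemLp.of_bound (hGm i).aestronglyMeasurable B (ae_of_all _ fun z => hGB i (z i))).const_mul a
  have hmain : Measurable fun p : E × (Fin m → List (Fin m) → E) =>
      (h p.1 + ∑ i, c i p.1 * G i (p.2 i)) ^ 2 := by fun_prop
  have hmain' : Measurable fun y : List (Fin m) → E =>
      (h (y []) + ∑ i, c i (y []) * G i (fun v => y (i :: v))) ^ 2 := by
    have h1 : ∀ i, Measurable fun y : List (Fin m) → E => G i (fun v => y (i :: v)) := fun i =>
      (hG i).comp (measurable_pi_lambda _ fun v => measurable_pi_apply _)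
    fun_prop
  -- With the root value fixed at `e`, the subtree terms are independent and centred: the cross
  -- terms vanish and the variance is additive.
  have hinner : ∀ e : E, ∫ z : Fin m → List (Fin m) → E,
      (h e + ∑ i, c i e * G i (z i)) ^ 2 ∂(Measure.pi fun _ => M) =
      h e ^ 2 + ∑ i, c i e ^ 2 * ∫ y, G i y ^ 2 ∂M := by
    intro e
    have hvar : Var[fun z => ∑ i, c i e * G i (z i); Measure.pi fun _ => M] =
        ∑ i, c i e ^ 2 * ∫ y, G i y ^ 2 ∂M := by
      have := IndepFun.variance_sum (μ := Measure.pi fun _ => M) (s := Finset.univ)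
        (X := fun (i : Fin m) (z : Fin m → List (Fin m) → E) => c i e * G i (z i))
        (fun i _ => hGmem i _) (fun i _ j _ hij =>
          (iIndepFun_pi (μ := fun _ : Fin m => M) (X := fun i y => c i e * G i y)
            (fun i => ((hG i).const_mul _).aemeasurable)).indepFun hij)
      rw [show (∑ i : Fin m, fun z : Fin m → List (Fin m) → E => c i e * G i (z i)) =
        fun z => ∑ i, c i e * G i (z i) from by ext z; simp] at this
      rw [this]
      refine Finset.sum_congr rfl fun i _ => ?_
      rw [variance_const_mul, variance_of_integral_eq_zero (hGm i).aemeasurable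
        (by rw [integral_pi_eval μ i (hG i)]; exact hG0 i),
        integral_pi_eval μ i (f := fun y => G i y ^ 2) ((hG i).pow_const 2)]
    have hmean : ∫ z, ∑ i, c i e * G i (z i) ∂(Measure.pi fun _ => M) = 0 := by
      rw [integral_finsetSum _ fun i _ => (hGmem i _).integrable (by norm_num)]
      refine Finset.sum_eq_zero fun i _ => ?_
      rw [integral_const_mul, integral_pi_eval μ i (hG i)]
      simp only [M, hG0, mul_zero]
    have hmem : MemLp (fun z : Fin m → List (Fin m) → E => ∑ i, c i e * G i (z i)) 2
        (Measure.pi fun _ => M) := memLp_finsetSum _ fun i _ => hGmem i _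
    rw [variance_of_integral_eq_zero hmem.aestronglyMeasurable.aemeasurable hmean] at hvar
    have hi := hmem.integrable (by norm_num)
    rw [← hvar]
    simp_rw [add_sq]
    rw [integral_add (by exact (integrable_const _).add (hi.const_mul _)) hmem.integrable_sq,
      integral_add (integrable_const _) (hi.const_mul _), integral_const_mul, hmean]
    simp
  rw [integral_tree μ hmain']
  change ∫ p : E × (Fin m → List (Fin m) → E), (h p.1 + ∑ i, c i p.1 * G i (p.2 i)) ^ 2
    ∂(μ.prod (Measure.pi fun _ => M)) = _
  rw [integral_prod]
  · simp_rw [hinner]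
    have hc2 : ∀ i, Integrable (fun e => c i e ^ 2) μ := fun i =>
      integrable_of_abs_le ((hc i).pow_const 2) (K := K ^ 2)
        fun e => by rw [abs_pow]; exact pow_le_pow_left₀ (abs_nonneg _) (hcK i e) 2
    rw [integral_add, integral_finsetSum _ fun i _ => (hc2 i).mul_const _]
    · simp_rw [integral_mul_const]
    · exact integrable_of_abs_le (hh.pow_const 2) (K := K ^ 2)
        fun e => by rw [abs_pow]; exact pow_le_pow_left₀ (abs_nonneg _) (hhK e) 2
    · exact integrable_finsetSum _ fun i _ => (hc2 i).mul_const _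
  · refine integrable_of_abs_le hmain (K := (K + ∑ i : Fin m, K * B) ^ 2) fun p => ?_
    rw [abs_pow]
    refine pow_le_pow_left₀ (abs_nonneg _) ?_ 2
    refine (abs_add_le _ _).trans (add_le_add (hhK _) ((Finset.abs_sum_le_sum_abs _ _).trans
      (Finset.sum_le_sum fun i _ => ?_)))
    rw [abs_mul]
    exact mul_le_mul (hcK _ _) (hGB _ _) (abs_nonneg _) hK

end

/-! ### Borel–Cantelli and second-moment inequalities -/

section
variable {α : Type*} [MeasurableSpace α]

theorem lintegral_ofReal_le {ν : Measure α} {f : α → ℝ} (hf0 : ∀ a, 0 ≤ f a)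
    (hfi : Integrable f ν) {u : ℝ} (h : ∫ a, f a ∂ν ≤ u) :
    ∫⁻ a, ENNReal.ofReal (f a) ∂ν ≤ ENNReal.ofReal u := by
  rw [← ofReal_integral_eq_lintegral_ofReal hfi (ae_of_all _ hf0)]
  exact ENNReal.ofReal_le_ofReal h

theorem lintegral_tsum_ofReal_le {ν : Measure α} {f : ℕ → α → ℝ} (hf : ∀ k, Measurable (f k))
    (hf0 : ∀ k a, 0 ≤ f k a) (hfi : ∀ k, Integrable (f k) ν) {u : ℕ → ℝ} (hu : Summable u)
    (h : ∀ k, ∫ a, f k a ∂ν ≤ u k) :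
    ∫⁻ a, ∑' k, ENNReal.ofReal (f k a) ∂ν ≤ ENNReal.ofReal (∑' k, u k) := by
  have hu0 : ∀ k, 0 ≤ u k := fun k => (integral_nonneg (hf0 k)).trans (h k)
  rw [lintegral_tsum fun k => (hf k).ennreal_ofReal.aemeasurable,
    ENNReal.ofReal_tsum_of_nonneg hu0 hu]
  exact ENNReal.tsum_le_tsum fun k => lintegral_ofReal_le (hf0 k) (hfi k) (h k)

/-- The series of the `f k` has finite expectation, hence converges almost surely, and so its terms
tend to zero. -/
theorem ae_tendsto_zero_of_summable_integral {ν : Measure α} {f : ℕ → α → ℝ}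
    (hf : ∀ k, Measurable (f k)) (hf0 : ∀ k a, 0 ≤ f k a) (hfi : ∀ k, Integrable (f k) ν)
    {u : ℕ → ℝ} (hu : Summable u) (h : ∀ k, ∫ a, f k a ∂ν ≤ u k) :
    ∀ᵐ a ∂ν, Tendsto (fun k => f k a) atTop (𝓝 0) := by
  have hlt : ∫⁻ a, ∑' k, ENNReal.ofReal (f k a) ∂ν ≠ ⊤ :=
    ((lintegral_tsum_ofReal_le hf hf0 hfi hu h).trans_lt ENNReal.ofReal_lt_top).ne
  have hm : Measurable fun a => ∑' k, ENNReal.ofReal (f k a) :=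
    Measurable.tsum fun k => (hf k).ennreal_ofReal
  filter_upwards [ae_lt_top hm hlt] with a ha
  have h1 := ENNReal.tendsto_atTop_zero_of_tsum_ne_top ha.ne
  have h2 := (ENNReal.tendsto_toReal ENNReal.zero_ne_top).comp h1
  refine (h2.congr fun k => ?_)
  simp [ENNReal.toReal_ofReal (hf0 k a)]

/-- A lower bound for the probability that a variable of mean one with bounded variance is at
least `1 / 2`. -/
theorem measureReal_half_le {ν : Measure α} [IsProbabilityMeasure ν] {f : α → ℝ}
    (hf : Measurable f) (hfi : Integrable f ν) (hf2 : Integrable (fun a => f a ^ 2) ν)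
    (h1 : ∫ a, f a ∂ν = 1) {V : ℝ} (hV0 : 0 ≤ V) (hV : ∫ a, (f a - 1) ^ 2 ∂ν ≤ V) :
    1 / (4 * (V + 1)) ≤ ν.real {a | 1 / 2 ≤ f a} := by
  set B := {a | 1 / 2 ≤ f a} with hB
  have hBm : MeasurableSet B := measurableSet_le measurable_const hf
  set t : ℝ := 1 / (2 * (V + 1)) with ht
  have htpos : 0 < t := by positivity
  have h2 : ∫ a, f a ^ 2 ∂ν ≤ V + 1 := by
    have : ∫ a, (f a - 1) ^ 2 ∂ν = ∫ a, f a ^ 2 ∂ν - 1 := by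
      have e : ∀ a, (f a - 1) ^ 2 = f a ^ 2 - 2 * f a + 1 := fun a => by ring
      simp_rw [e]
      rw [integral_add (by exact hf2.sub (hfi.const_mul _)) (integrable_const _),
        integral_sub hf2 (hfi.const_mul _), integral_const_mul, h1]
      simp; ring
    linarith
  -- On the event `B` the bound is `f ≤ t f²/2 + 1/(2t)`, off it `f < 1/2`. The choice of `t` makes
  -- the quadratic term contribute at most `1/4`, so integration leaves `1/4 ≤ (V + 1) ν(B)`.
  have hpt : ∀ a, f a ≤ 1 / 2 + t / 2 * f a ^ 2 + 1 / (2 * t) * B.indicator 1 a := by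
    intro a
    by_cases ha : a ∈ B
    · rw [Set.indicator_of_mem ha]
      have : f a ≤ t / 2 * f a ^ 2 + 1 / (2 * t) := by
        have h : 0 ≤ (t * f a - 1) ^ 2 / (2 * t) := by positivity
        have e : (t * f a - 1) ^ 2 / (2 * t) = t / 2 * f a ^ 2 + 1 / (2 * t) - f a := by
          field_simp; ring
        linarith
      simp only [Pi.one_apply, mul_one]
      linarith
    · rw [Set.indicator_of_notMem ha]
      have : f a < 1 / 2 := by simpa [hB] using ha
      have h : 0 ≤ t / 2 * f a ^ 2 := by positivity
      linarith
  have hind : Integrable (B.indicator (1 : α → ℝ)) ν := (integrable_const 1).indicator hBm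
  have hI := integral_mono hfi
    (((integrable_const (1 / 2 : ℝ)).add (hf2.const_mul (t / 2))).add
      (hind.const_mul (1 / (2 * t)))) hpt
  simp only [Pi.add_apply] at hI
  rw [integral_add (by exact (integrable_const _).add (hf2.const_mul _)) (hind.const_mul _),
    integral_add (integrable_const _) (hf2.const_mul _), integral_const_mul, integral_const_mul,
    integral_indicator_one hBm, h1] at hI
  simp only [integral_const, probReal_univ, smul_eq_mul, one_mul] at hI
  have h3 : t / 2 * ∫ a, f a ^ 2 ∂ν ≤ 1 / 4 := by
    calc _ ≤ t / 2 * (V + 1) := by gcongr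
      _ = 1 / 4 := by rw [ht]; field_simp; norm_num
  have h4 : 1 / 4 ≤ 1 / (2 * t) * ν.real B := by linarith
  have h5 : 1 / (2 * t) = V + 1 := by rw [ht]; field_simp
  rw [h5] at h4
  rw [div_le_iff₀ (by positivity)]
  linarith

end

/-! ### Stopping lines explored to sufficient depth -/

section
variable {E : Type*} {m : ℕ} (c : Fin m → E → ℝ) (l : Fin m → ℝ) (L : ℝ)

/-- The least number of generations after which a product of ratios at most `L` is at most `x`. -/
noncomputable def fuel (x : ℝ) : ℕ := sInf {n : ℕ | L ^ n ≤ x}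

theorem pow_fuel_le {L : ℝ} (hL1 : L < 1) {x : ℝ} (hx : 0 < x) :
    L ^ fuel L x ≤ x := by
  obtain ⟨n, hn⟩ := exists_pow_lt_of_lt_one hx hL1
  exact Nat.sInf_mem (s := {n : ℕ | L ^ n ≤ x}) ⟨n, hn.le⟩

/-- The total weight of the full stopping line at level `x`. -/
noncomputable def line (x : ℝ) (y : List (Fin m) → E) : ℝ := casc c l (fuel L x) x y

/-- The numbers `l i` are positive and at most `L`, where `0 < L < 1`. -/
structure IsRatio (l : Fin m → ℝ) (L : ℝ) : Prop where
  pos : 0 < L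
  lt_one : L < 1
  apply_pos : ∀ i, 0 < l i
  apply_le : ∀ i, l i ≤ L

/-- Measurable weights with values in the unit interval. -/
structure IsWeight [MeasurableSpace E] (c : Fin m → E → ℝ) : Prop where
  measurable : ∀ i, Measurable (c i)
  nonneg : ∀ i e, 0 ≤ c i e
  le_one : ∀ i e, c i e ≤ 1

variable {c l L}

theorem IsRatio.pow_le_div (hl : IsRatio l L) {n : ℕ} {x : ℝ} (h : L ^ (n + 1) ≤ x) (i : Fin m) :
    L ^ n ≤ x / l i := by
  have := hl.pos
  rw [le_div_iff₀ (hl.apply_pos i)]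
  calc L ^ n * l i ≤ L ^ n * L := by gcongr; exact hl.apply_le i
    _ ≤ x := by rwa [← pow_succ]

theorem line_eq_casc (hl : IsRatio l L) {n : ℕ} {x : ℝ} (hn : L ^ n ≤ x) (y : List (Fin m) → E) :
    line c l L x y = casc c l n x y :=
  casc_fuel c l hl.pos hl.apply_pos hl.apply_le
    (pow_fuel_le hl.lt_one ((pow_pos hl.pos n).trans_le hn)) hn y

/-- The depth `fuel` differs between the tree and its subtrees; one common sufficient depth serves
for all of them. -/
theorem line_eq_sum (hl : IsRatio l L) {x : ℝ} (hx : 0 < x) (hx1 : x < 1)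
    (y : List (Fin m) → E) :
    line c l L x y = ∑ i, c i (y []) * line c l L (x / l i) (fun v => y (i :: v)) := by
  obtain ⟨n, hn⟩ := exists_pow_lt_of_lt_one hx hl.lt_one
  have hn1 : L ^ (n + 1) ≤ x := by
    rw [pow_succ]; exact (mul_le_of_le_one_right (pow_pos hl.pos n).le hl.lt_one.le).trans hn.le
  rw [line_eq_casc hl hn1, casc_succ c l hx1]
  exact Finset.sum_congr rfl fun i _ => by rw [line_eq_casc hl (hl.pow_le_div hn1 i)]

theorem line_nonneg (hc : ∀ i e, 0 ≤ c i e) (x : ℝ) (y : List (Fin m) → E) :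
    0 ≤ line c l L x y := casc_nonneg c l hc _ _ _

theorem measurable_line [MeasurableSpace E] (hc : ∀ i, Measurable (c i)) (x : ℝ) :
    Measurable (line c l L x) := measurable_casc c l hc _ _

end

/-! ### Moment bounds for stopping line sums -/

section
variable {E : Type*} [MeasurableSpace E] {m : ℕ} {μ : Measure E} [IsProbabilityMeasure μ]
  {c : Fin m → E → ℝ} {l : Fin m → ℝ} {L : ℝ}

theorem IsWeight.abs_le (hc : IsWeight c) (i : Fin m) (e : E) : |c i e| ≤ 1 := by
  rw [abs_of_nonneg (hc.nonneg i e)]; exact hc.le_one i e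

theorem IsWeight.abs_casc_le (hc : IsWeight c) (n : ℕ) (x : ℝ) (y : List (Fin m) → E) :
    |casc c l n x y| ≤ ((m : ℝ) + 1) ^ n := by
  rw [abs_of_nonneg (casc_nonneg c l hc.nonneg _ _ _)]
  exact casc_le c l hc.nonneg hc.le_one _ _ _

theorem IsWeight.integrable_casc (hc : IsWeight c) (n : ℕ) (x : ℝ) :
    Integrable (casc c l n x) (treeMeasure m μ) :=
  integrable_of_abs_le (measurable_casc c l hc.measurable n x) (hc.abs_casc_le n x)

theorem IsWeight.integrable_line (hc : IsWeight c) (x : ℝ) :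
    Integrable (line c l L x) (treeMeasure m μ) := hc.integrable_casc _ _

theorem IsWeight.integral_casc (hc : IsWeight c) (hsum : ∑ i, ∫ e, c i e ∂μ = 1)
    (n : ℕ) (x : ℝ) : ∫ y, casc c l n x y ∂(treeMeasure m μ) = 1 :=
  RandomSelfAffine.integral_casc μ l hc.measurable hc.nonneg hc.le_one hsum n x

/-- If the total mean weight is less than one, the sums over the generations tend to zero. -/
theorem ae_tendsto_casc_level (hc : IsWeight c) (hsum : ∑ i, ∫ e, c i e ∂μ < 1) :
    ∀ᵐ y ∂(treeMeasure m μ), Tendsto (fun n => casc c l n 0 y) atTop (𝓝 0) := by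
  have h0 : 0 ≤ ∑ i, ∫ e, c i e ∂μ :=
    Finset.sum_nonneg fun i _ => integral_nonneg (hc.nonneg i)
  exact ae_tendsto_zero_of_summable_integral (fun n => measurable_casc c l hc.measurable n 0)
    (fun n y => casc_nonneg c l hc.nonneg n 0 y) (fun n => hc.integrable_casc n 0)
    (summable_geometric_of_lt_one h0 hsum)
    (fun n => (integral_casc_level μ l hc.measurable hc.nonneg hc.le_one n).le)

/-- Almost surely, the stopping line sums grow slower than any power. -/
theorem ae_tendsto_rpow_mul_line (hc : IsWeight c) (hsum : ∑ i, ∫ e, c i e ∂μ = 1) {ε : ℝ}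
    (hε : 0 < ε) : ∀ᵐ y ∂(treeMeasure m μ),
      Tendsto (fun k : ℕ => ((1 / 2 : ℝ) ^ ε) ^ k * line c l L ((1 / 2) ^ k) y) atTop (𝓝 0) := by
  have hq0 : 0 ≤ (1 / 2 : ℝ) ^ ε := by positivity
  have hq1 : (1 / 2 : ℝ) ^ ε < 1 := Real.rpow_lt_one (by norm_num) (by norm_num) hε
  refine ae_tendsto_zero_of_summable_integral
    (fun k => (measurable_line hc.measurable _).const_mul _)
    (fun k y => mul_nonneg (pow_nonneg hq0 k) (line_nonneg hc.nonneg _ _))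
    (fun k => (hc.integrable_line _).const_mul _) (summable_geometric_of_lt_one hq0 hq1)
    -- The line sum has mean one, so the `k`-th integral is exactly the `k`-th term of the geometric
    -- series.
    (fun k => ?_)
  rw [integral_const_mul]
  unfold line
  rw [hc.integral_casc hsum, mul_one]

/-- One generation turns a variance bound `v` into `K + ρ v`, with `K` coming from the root and `ρ =
∑ E c_i² < 1`. The fixed point `K / (1 - ρ)` therefore bounds all depths and all levels. -/
theorem exists_variance_bound (hc : IsWeight c) (hsum : ∑ i, ∫ e, c i e ∂μ = 1)
    (hsq : ∑ i, ∫ e, c i e ^ 2 ∂μ < 1) :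
    ∃ V : ℝ, 0 ≤ V ∧ ∀ n x, ∫ y, (casc c l n x y - 1) ^ 2 ∂(treeMeasure m μ) ≤ V := by
  set ρ := ∑ i, ∫ e, c i e ^ 2 ∂μ with hρ
  set K := ∫ e, (∑ i, c i e - 1) ^ 2 ∂μ with hK
  have hK0 : 0 ≤ K := integral_nonneg fun e => sq_nonneg _
  have hV0 : 0 ≤ K / (1 - ρ) := div_nonneg hK0 (by linarith)
  refine ⟨K / (1 - ρ), hV0, fun n => ?_⟩
  induction n with
  | zero => intro x; simpa using hV0
  | succ n ih =>
    intro x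
    rcases le_or_gt 1 x with hx | hx
    · simpa [casc_of_one_le c l hx] using hV0
    · have e : ∀ y : List (Fin m) → E, casc c l (n + 1) x y - 1 =
          (∑ i, c i (y []) - 1) +
            ∑ i, c i (y []) * (casc c l n (x / l i) (fun v => y (i :: v)) - 1) := by
        intro y
        rw [casc_succ c l hx]
        simp_rw [mul_sub, mul_one, Finset.sum_sub_distrib]
        ring
      simp_rw [e]
      have hcm := hc.measurable
      rw [integral_sq_subtree μ hc.measurable (K := (m : ℝ) + 1)
        (fun i e => (hc.abs_le i e).trans (by linarith [Nat.cast_nonneg (α := ℝ) m]))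
        (h := fun e => ∑ i, c i e - 1) (by fun_prop) (fun e => ?_)
        (G := fun i y => casc c l n (x / l i) y - 1)
        (fun i => (measurable_casc c l hcm n _).sub_const 1)
        (B := ((m : ℝ) + 1) ^ n + 1) (fun i y => ?_) (fun i => ?_)]
      · calc _ ≤ K + ∑ i, (∫ e, c i e ^ 2 ∂μ) * (K / (1 - ρ)) := by
              gcongr with i _
              exact ih _
          _ = K + ρ * (K / (1 - ρ)) := by rw [← Finset.sum_mul]
          _ = K / (1 - ρ) := by
              have : 1 - ρ ≠ 0 := by linarith
              field_simp
              ring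
          _ ≤ _ := le_rfl
      · refine (abs_sub _ _).trans (add_le_add ?_ (by simp))
        calc _ ≤ ∑ i : Fin m, (1 : ℝ) := (Finset.abs_sum_le_sum_abs _ _).trans
              (Finset.sum_le_sum fun i _ => hc.abs_le i e)
          _ = m := by simp
      · exact (abs_sub _ _).trans (add_le_add (hc.abs_casc_le _ _ _) (by simp))
      · rw [integral_sub (hc.integrable_casc _ _) (integrable_const _), hc.integral_casc hsum]
        simp

/-- The second moment of the change between two stopping lines. -/
theorem integral_sq_casc_sub_le (hl : ∀ i, 0 < l i) (hc : IsWeight c)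
    (hsum : ∑ i, ∫ e, c i e ∂μ = 1) {κ : ℝ} (hκ : 0 ≤ κ)
    (hsq : ∑ i, (∫ e, c i e ^ 2 ∂μ) / l i ^ κ ≤ 1) {V : ℝ}
    (hV : ∀ n x, ∫ y, (casc c l n x y - 1) ^ 2 ∂(treeMeasure m μ) ≤ V) (n : ℕ) {x x' : ℝ}
    (hx' : 0 < x') (hxx' : x' ≤ x) :
    ∫ y, (casc c l n x' y - casc c l n x y) ^ 2 ∂(treeMeasure m μ) ≤ V * x ^ κ := by
  have hV0 : 0 ≤ V := (integral_nonneg fun y => sq_nonneg _).trans (hV 0 0)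
  induction n generalizing x x' with
  | zero => simpa using mul_nonneg hV0 (Real.rpow_nonneg (hx'.le.trans hxx') κ)
  | succ n ih =>
    have hx0 : 0 < x := hx'.trans_le hxx'
    rcases le_or_gt 1 x with hx | hx
    · simp only [casc_of_one_le c l hx]
      exact (hV _ _).trans (le_mul_of_one_le_right hV0 (Real.one_le_rpow hx hκ))
    -- Below level one neither line stops at the root, so both carry the same root weights and the
    -- root term of the difference is zero. The bound `V x^κ` reproduces itself because `∑ E c_i² /
    -- l_i^κ ≤ 1`.
    · have e : ∀ y : List (Fin m) → E, casc c l (n + 1) x' y - casc c l (n + 1) x y =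
          (fun _ => (0 : ℝ)) (y []) + ∑ i, c i (y []) * (casc c l n (x' / l i) (fun v => y (i :: v)) -
            casc c l n (x / l i) (fun v => y (i :: v))) := by
        intro y
        rw [casc_succ c l hx, casc_succ c l (hxx'.trans_lt hx)]
        simp_rw [mul_sub, Finset.sum_sub_distrib]
        ring
      simp_rw [e]
      have hcm := hc.measurable
      rw [integral_sq_subtree μ hc.measurable (K := 1) hc.abs_le (h := fun _ => 0)
        measurable_const (fun e => by simp)
        (G := fun i y => casc c l n (x' / l i) y - casc c l n (x / l i) y)
        (fun i => (measurable_casc c l hcm n _).sub (measurable_casc c l hcm n _))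
        (B := ((m : ℝ) + 1) ^ n + ((m : ℝ) + 1) ^ n)
        (fun i y => (abs_sub _ _).trans (add_le_add (hc.abs_casc_le _ _ _) (hc.abs_casc_le _ _ _)))
        (fun i => ?_)]
      · calc _ ≤ ∫ e : E, (0 : ℝ) ^ 2 ∂μ + ∑ i, (∫ e, c i e ^ 2 ∂μ) * (V * (x / l i) ^ κ) := by
              gcongr with i _
              exact ih (div_pos hx' (hl i)) (by have := hl i; gcongr)
          _ = V * x ^ κ * ∑ i, (∫ e, c i e ^ 2 ∂μ) / l i ^ κ := by
              rw [Finset.mul_sum]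
              simp only [ne_eq, OfNat.ofNat_ne_zero, not_false_eq_true, zero_pow, integral_zero,
                zero_add]
              refine Finset.sum_congr rfl fun i _ => ?_
              rw [Real.div_rpow hx0.le (hl i).le]
              ring
          _ ≤ V * x ^ κ := mul_le_of_le_one_right (by positivity) hsq
      · rw [integral_sub (hc.integrable_casc _ _) (hc.integrable_casc _ _), hc.integral_casc hsum,
          hc.integral_casc hsum, sub_self]

end

/-! ### Stopping line sums stay away from zero -/

section
variable {E : Type*} [MeasurableSpace E] {m : ℕ} {μ : Measure E} [IsProbabilityMeasure μ]
  {c : Fin m → E → ℝ} {l : Fin m → ℝ} {L : ℝ}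

theorem integral_sq_line_sub_le (hl : IsRatio l L) (hc : IsWeight c)
    (hsum : ∑ i, ∫ e, c i e ∂μ = 1) {κ : ℝ} (hκ : 0 ≤ κ)
    (hsq : ∑ i, (∫ e, c i e ^ 2 ∂μ) / l i ^ κ ≤ 1) {V : ℝ}
    (hV : ∀ n x, ∫ y, (casc c l n x y - 1) ^ 2 ∂(treeMeasure m μ) ≤ V) {x x' : ℝ}
    (hx' : 0 < x') (hxx' : x' ≤ x) :
    ∫ y, (line c l L x' y - line c l L x y) ^ 2 ∂(treeMeasure m μ) ≤ V * x ^ κ := by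
  have h := pow_fuel_le hl.lt_one hx'
  simp_rw [line_eq_casc (c := c) hl h, line_eq_casc (c := c) hl (h.trans hxx')]
  exact integral_sq_casc_sub_le hl.apply_pos hc hsum hκ hsq hV _ hx' hxx'

/-- The stopping line sums stay bounded below with a probability bounded below. -/
theorem exists_prob_line_ge (hl : IsRatio l L) (hc : IsWeight c)
    (hsum : ∑ i, ∫ e, c i e ∂μ = 1) {κ : ℝ} (hκ : 0 < κ)
    (hsq1 : ∑ i, ∫ e, c i e ^ 2 ∂μ < 1)
    (hsq : ∑ i, (∫ e, c i e ^ 2 ∂μ) / l i ^ κ ≤ 1) :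
    ∃ p : ℝ, 0 < p ∧ ∀ x : ℝ, 0 < x →
      ENNReal.ofReal p ≤ treeMeasure m μ
        {y | ∃ a : ℝ, 0 < a ∧ ∀ᶠ k : ℕ in atTop, a ≤ line c l L (x * (1 / 2) ^ k) y} := by
  obtain ⟨V, hV0, hV⟩ := exists_variance_bound (l := l) hc hsum hsq1
  set M := treeMeasure m μ
  set p₀ : ℝ := 1 / (4 * (V + 1)) with hp₀
  have hp₀pos : 0 < p₀ := by positivity
  set r : ℝ := (1 / 2 : ℝ) ^ (κ / 2) with hr
  have hr0 : 0 < r := by positivity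
  have hr1 : r < 1 := Real.rpow_lt_one (by norm_num) (by norm_num) (by positivity)
  set C : ℝ := (V + 1) / 2
  have hC : 0 < C := by positivity
  refine ⟨p₀ / 2, by positivity, fun x hx => ?_⟩
  have hlim : Tendsto (fun k : ℕ => 4 * (C * x ^ (κ / 2) * (1 - r)⁻¹ * r ^ k)) atTop (𝓝 0) := by
    simpa using ((tendsto_pow_atTop_nhds_zero_of_lt_one hr0.le hr1).const_mul
      (C * x ^ (κ / 2) * (1 - r)⁻¹)).const_mul 4
  -- Past `k₀` the total variation exceeds `1/4` with probability at most `p₀ / 2`; the factor `4`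
  -- in `hlim` comes from Markov's inequality at level `1/4`. The index `k₀` depends on `x`, the
  -- probability does not.
  obtain ⟨k₀, hk₀⟩ := (hlim.eventually (gt_mem_nhds (half_pos hp₀pos))).exists
  set d : ℕ → (List (Fin m) → E) → ℝ := fun k y =>
    |line c l L (x * (1 / 2) ^ (k₀ + k + 1)) y - line c l L (x * (1 / 2) ^ (k₀ + k)) y| with hd
  have hxk : ∀ k : ℕ, 0 < x * (1 / 2 : ℝ) ^ k := fun k => by positivity
  have hlm : ∀ x, Measurable (line c l L x) := measurable_line hc.measurable
  have hdm : ∀ k, Measurable (d k) := fun k => ((hlm _).sub (hlm _)).abs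
  have hdi : ∀ k, Integrable (d k) M := fun k =>
    ((hc.integrable_line _).sub (hc.integrable_line _)).abs
  have hpow : ∀ k : ℕ, (x * (1 / 2 : ℝ) ^ k) ^ (κ / 2) = x ^ (κ / 2) * r ^ k := fun k => by
    rw [Real.mul_rpow hx.le (by positivity), hr, ← Real.rpow_natCast, ← Real.rpow_natCast,
      ← Real.rpow_mul (by norm_num), ← Real.rpow_mul (by norm_num), mul_comm (k : ℝ)]
  have hdint : ∀ k, ∫ y, d k y ∂M ≤ C * x ^ (κ / 2) * r ^ k₀ * r ^ k := by
    intro k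
    set z := x * (1 / 2 : ℝ) ^ (k₀ + k) with hz
    have hz0 : 0 < z := hxk _
    set τ := z ^ (κ / 2) with hτ
    have hτ0 : 0 < τ := Real.rpow_pos_of_pos hz0 _
    have hττ : z ^ κ = τ * τ := by rw [hτ, ← Real.rpow_add hz0]; ring_nf
    have h2 := integral_sq_line_sub_le hl hc hsum hκ.le hsq hV (hxk (k₀ + k + 1))
      (x := z) (by rw [hz, pow_succ, ← mul_assoc]; linarith)
    have hsqi : Integrable (fun y => (line c l L (x * (1 / 2) ^ (k₀ + k + 1)) y -
        line c l L z y) ^ 2) M := by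
      refine integrable_of_abs_le (((hlm _).sub (hlm _)).pow_const 2)
        (K := (((m : ℝ) + 1) ^ fuel L (x * (1 / 2) ^ (k₀ + k + 1)) + ((m : ℝ) + 1) ^ fuel L z) ^ 2) fun y => ?_
      rw [abs_pow]
      exact pow_le_pow_left₀ (abs_nonneg _)
        ((abs_sub _ _).trans (add_le_add (hc.abs_casc_le _ _ _) (hc.abs_casc_le _ _ _))) 2
    -- From second to first moment: with `τ² = z^κ` and second moment at most `V τ²`, this pointwise
    -- inequality integrates to `(V + 1)/2 · τ = C τ`.
    have hpt : ∀ y, d k y ≤ (2 * τ)⁻¹ * (line c l L (x * (1 / 2) ^ (k₀ + k + 1)) y -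
        line c l L z y) ^ 2 + τ / 2 := by
      intro y
      simp only [hd]
      set u := line c l L (x * (1 / 2) ^ (k₀ + k + 1)) y - line c l L z y
      have h : 0 ≤ (2 * τ)⁻¹ * (|u| - τ) ^ 2 := by positivity
      have e : (2 * τ)⁻¹ * (|u| - τ) ^ 2 = (2 * τ)⁻¹ * u ^ 2 + τ / 2 - |u| := by
        rw [← sq_abs u]; field_simp; ring
      linarith
    calc ∫ y, d k y ∂M ≤ _ := integral_mono (hdi k)
          ((hsqi.const_mul (2 * τ)⁻¹).add (integrable_const (τ / 2))) hpt
      _ = (2 * τ)⁻¹ * ∫ y, (line c l L (x * (1 / 2) ^ (k₀ + k + 1)) y -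
        line c l L z y) ^ 2 ∂M + τ / 2 := by
          simp only [Pi.add_apply]
          rw [integral_add (hsqi.const_mul _) (integrable_const _), integral_const_mul]
          simp
      _ ≤ (2 * τ)⁻¹ * (V * z ^ κ) + τ / 2 := by gcongr
      _ = C * τ := by rw [hττ]; simp only [C]; field_simp
      _ = _ := by rw [hτ, hz, hpow, pow_add]; ring
  have hQ := lintegral_tsum_ofReal_le hdm (fun k y => abs_nonneg _) hdi
    ((summable_geometric_of_lt_one hr0.le hr1).mul_left (C * x ^ (κ / 2) * r ^ k₀)) hdint
  rw [tsum_mul_left, tsum_geometric_of_lt_one hr0.le hr1] at hQ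
  set Q : (List (Fin m) → E) → ENNReal := fun y => ∑' k, ENNReal.ofReal (d k y) with hQdef
  have hmark : M {y | ENNReal.ofReal (1 / 4) ≤ Q y} ≤ ENNReal.ofReal (p₀ / 2) := by
    have hQm : Measurable Q := Measurable.tsum fun k => (hdm k).ennreal_ofReal
    have h1 := mul_meas_ge_le_lintegral (μ := M) hQm (ENNReal.ofReal (1 / 4))
    have h2 := mul_le_mul_right (h1.trans hQ) (ENNReal.ofReal 4)
    rw [← mul_assoc, ← ENNReal.ofReal_mul (by norm_num), ← ENNReal.ofReal_mul (by norm_num),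
      show (4 : ℝ) * (1 / 4) = 1 by norm_num, ENNReal.ofReal_one, one_mul] at h2
    refine h2.trans (ENNReal.ofReal_le_ofReal ?_)
    calc _ = 4 * (C * x ^ (κ / 2) * (1 - r)⁻¹ * r ^ k₀) := by ring
      _ ≤ _ := hk₀.le
  have hhalf : ENNReal.ofReal p₀ ≤ M {y | 1 / 2 ≤ line c l L (x * (1 / 2) ^ k₀) y} := by
    have := measureReal_half_le (ν := M) (hlm (x * (1 / 2) ^ k₀)) (hc.integrable_line _)
      (integrable_of_abs_le ((hlm _).pow_const 2) (K := (((m : ℝ) + 1) ^ fuel L (x * (1 / 2) ^ k₀)) ^ 2) fun y => by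
        rw [abs_pow]; exact pow_le_pow_left₀ (abs_nonneg _) (hc.abs_casc_le _ _ _) 2)
      (hc.integral_casc hsum _ _) hV0 (hV _ _)
    rw [← ofReal_measureReal]
    exact ENNReal.ofReal_le_ofReal this
  -- A sum that is at least `1/2` at step `k₀` and varies by at most `1/4` in total afterwards stays
  -- at least `1/4`.
  have hsub : {y | 1 / 2 ≤ line c l L (x * (1 / 2) ^ k₀) y} ⊆
      {y | ENNReal.ofReal (1 / 4) ≤ Q y} ∪
      {y | ∃ a : ℝ, 0 < a ∧ ∀ᶠ k : ℕ in atTop, a ≤ line c l L (x * (1 / 2) ^ k) y} := by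
    intro y hy
    rw [Set.mem_ofPred_eq] at hy
    by_cases hq : ENNReal.ofReal (1 / 4) ≤ Q y
    · exact Or.inl hq
    refine Or.inr ⟨1 / 4, by norm_num, ?_⟩
    have hbound : ∀ n : ℕ, ∑ k ∈ Finset.range n, d k y ≤ 1 / 4 := by
      intro n
      have h1 : ENNReal.ofReal (∑ k ∈ Finset.range n, d k y) ≤ Q y := by
        rw [ENNReal.ofReal_sum_of_nonneg fun k _ => abs_nonneg _]
        exact ENNReal.sum_le_tsum _
      exact (ENNReal.ofReal_le_ofReal_iff (by norm_num)).1 (h1.trans (not_le.1 hq).le)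
    refine eventually_atTop.2 ⟨k₀, fun k hk => ?_⟩
    obtain ⟨n, rfl⟩ := Nat.exists_eq_add_of_le hk
    have htel : line c l L (x * (1 / 2) ^ k₀) y - ∑ k ∈ Finset.range n, d k y ≤
        line c l L (x * (1 / 2) ^ (k₀ + n)) y := by
      clear hk
      induction n with
      | zero => simp
      | succ n ih =>
        rw [Finset.sum_range_succ]
        have := neg_abs_le (line c l L (x * (1 / 2) ^ (k₀ + n + 1)) y -
          line c l L (x * (1 / 2) ^ (k₀ + n)) y)
        rw [← add_assoc]
        simp only [hd] at ih ⊢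
        linarith
    linarith [hbound n]
  have h3 := hhalf.trans ((measure_mono hsub).trans (measure_union_le _ _))
  have h4 : ENNReal.ofReal p₀ = ENNReal.ofReal (p₀ / 2) + ENNReal.ofReal (p₀ / 2) := by
    rw [← ENNReal.ofReal_add (by positivity) (by positivity), add_halves]
  rw [h4] at h3
  exact (ENNReal.add_le_add_iff_left ENNReal.ofReal_ne_top).1
    (h3.trans (add_le_add hmark le_rfl))

theorem measurableSet_line_ge (hc : IsWeight c) (x : ℝ) :
    MeasurableSet {y : List (Fin m) → E |
      ∃ a : ℝ, 0 < a ∧ ∀ᶠ k : ℕ in atTop, a ≤ line c l L (x * (1 / 2) ^ k) y} := by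
  have : {y : List (Fin m) → E |
      ∃ a : ℝ, 0 < a ∧ ∀ᶠ k : ℕ in atTop, a ≤ line c l L (x * (1 / 2) ^ k) y} =
      ⋃ j : ℕ, ⋃ K : ℕ, ⋂ k : ℕ, ⋂ _ : K ≤ k,
        {y | (1 : ℝ) / (j + 1) ≤ line c l L (x * (1 / 2) ^ k) y} := by
    ext y
    simp only [Set.mem_ofPred_eq, eventually_atTop, Set.mem_iUnion, Set.mem_iInter]
    constructor
    · rintro ⟨a, ha, K, hK⟩
      obtain ⟨j, hj⟩ := exists_nat_one_div_lt ha
      exact ⟨j, K, fun k hk => hj.le.trans (hK k hk)⟩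
    · rintro ⟨j, K, hK⟩
      exact ⟨_, by positivity, K, hK⟩
  rw [this]
  exact MeasurableSet.iUnion fun j => MeasurableSet.iUnion fun K => MeasurableSet.iInter fun k =>
    MeasurableSet.iInter fun _ => measurableSet_le measurable_const (measurable_line hc.measurable _)

/-- If almost surely at least two weights at the root are positive, then almost surely the
stopping line sums stay bounded below. -/
theorem ae_line_ge (hl : IsRatio l L) (hc : IsWeight c)
    (hsum : ∑ i, ∫ e, c i e ∂μ = 1) {κ : ℝ} (hκ : 0 < κ)
    (hsq1 : ∑ i, ∫ e, c i e ^ 2 ∂μ < 1)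
    (hsq : ∑ i, (∫ e, c i e ^ 2 ∂μ) / l i ^ κ ≤ 1)
    (htwo : ∀ᵐ e ∂μ, ∃ i j, i ≠ j ∧ 0 < c i e ∧ 0 < c j e) :
    ∀ᵐ y ∂(treeMeasure m μ),
      ∃ a : ℝ, 0 < a ∧ ∀ᶠ k : ℕ in atTop, a ≤ line c l L ((1 / 2) ^ k) y := by
  classical
  obtain ⟨p, hp0, hp⟩ := exists_prob_line_ge hl hc hsum hκ hsq1 hsq
  set M := treeMeasure m μ with hM
  set G : ℝ → Set (List (Fin m) → E) := fun x =>
    {y | ∃ a : ℝ, 0 < a ∧ ∀ᶠ k : ℕ in atTop, a ≤ line c l L (x * (1 / 2) ^ k) y} with hG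
  have hGm : ∀ x, MeasurableSet (G x) := measurableSet_line_ge hc
  -- The supremum is over all starting levels, because the subtree of `i` sees the level `x / l i`.
  set q : ENNReal := ⨆ x : Set.Ioi (0 : ℝ), M (G x)ᶜ with hq
  have hqle : ∀ x, 0 < x → M (G x)ᶜ ≤ q := fun x hx =>
    le_iSup (fun x : Set.Ioi (0 : ℝ) => M (G x)ᶜ) ⟨x, hx⟩
  have hq1 : q < 1 := by
    have h1 : q ≤ 1 - ENNReal.ofReal p := by
      refine iSup_le fun x => ?_
      rw [prob_compl_eq_one_sub (hGm _)]
      exact tsub_le_tsub_left (hp x x.2) 1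
    exact h1.trans_lt (ENNReal.sub_lt_self ENNReal.one_ne_top one_ne_zero
      (ENNReal.ofReal_pos.2 hp0).ne')
  -- Failure at the root forces failure in every subtree of positive weight. Two such subtrees exist
  -- and are independent, hence the bound `q * q`.
  have hstep : ∀ x : ℝ, 0 < x → M (G x)ᶜ ≤ q * q := by
    intro x hx
    set B : Set (E × (Fin m → List (Fin m) → E)) :=
      ⋂ i, ({p | c i p.1 ≤ 0} ∪ {p | p.2 i ∈ (G (x / l i))ᶜ}) with hB
    have hBm : MeasurableSet B := MeasurableSet.iInter fun i =>
      (measurableSet_le ((hc.measurable i).comp measurable_fst) measurable_const).union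
        (((measurable_pi_apply i).comp measurable_snd) (hGm _).compl)
    have hsub : joinTree ⁻¹' (G x)ᶜ ⊆ B := by
      rintro ⟨e, z⟩ hy
      simp only [hB, Set.mem_iInter, Set.mem_union, Set.mem_ofPred_eq]
      intro i
      by_contra hcon
      rw [not_or, not_le, Set.notMem_compl_iff] at hcon
      obtain ⟨hci, a, ha, hev⟩ := hcon
      refine hy ⟨c i e * a, mul_pos hci ha, ?_⟩
      have hlim : Tendsto (fun k : ℕ => x * (1 / 2 : ℝ) ^ k) atTop (𝓝 0) := by
        simpa using (tendsto_pow_atTop_nhds_zero_of_lt_one (by norm_num : (0 : ℝ) ≤ 1 / 2)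
          (by norm_num)).const_mul x
      filter_upwards [hev, hlim.eventually (gt_mem_nhds zero_lt_one)] with k hk hk1
      rw [line_eq_sum hl (by positivity) hk1]
      refine le_trans ?_ (Finset.single_le_sum (fun j _ => mul_nonneg (hc.nonneg j _)
        (line_nonneg hc.nonneg _ _)) (Finset.mem_univ i))
      have e1 : x * (1 / 2 : ℝ) ^ k / l i = x / l i * (1 / 2) ^ k := by ring
      rw [e1]
      exact mul_le_mul_of_nonneg_left hk hci.le
    rw [← (measurePreserving_joinTree (m := m) μ).measure_preimage (hGm x).compl.nullMeasurableSet]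
    refine (measure_mono hsub).trans ?_
    rw [Measure.prod_apply hBm]
    have hsec : ∀ᵐ e ∂μ, (Measure.pi fun _ : Fin m => M) (Prod.mk e ⁻¹' B) ≤ q * q := by
      filter_upwards [htwo] with e he
      obtain ⟨i, j, hij, hi, hj⟩ := he
      have hset : Prod.mk e ⁻¹' B =
          Set.univ.pi fun i => if 0 < c i e then (G (x / l i))ᶜ else Set.univ := by
        ext z
        simp only [hB, Set.mem_preimage, Set.mem_iInter, Set.mem_union, Set.mem_ofPred_eq,
          Set.mem_pi, Set.mem_univ, true_implies]
        refine forall_congr' fun i => ?_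
        split_ifs with h
        · simp [not_le.2 h]
        · simp [not_lt.1 h]
      rw [hset, Measure.pi_pi, ← Finset.mul_prod_erase _ _ (Finset.mem_univ i),
        ← Finset.mul_prod_erase _ _ (Finset.mem_erase.2 ⟨hij.symm, Finset.mem_univ j⟩), ← mul_assoc]
      rw [if_pos hi, if_pos hj]
      refine (mul_le_mul' (mul_le_mul' (hqle _ (div_pos hx (hl.apply_pos i)))
        (hqle _ (div_pos hx (hl.apply_pos j)))) (Finset.prod_le_one' fun k _ => prob_le_one)).trans ?_
      rw [mul_one]
    calc _ ≤ ∫⁻ _ : E, q * q ∂μ := lintegral_mono_ae hsec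
      _ = q * q := by simp
  have hqq : q ≤ q * q := iSup_le fun x => hstep x x.2
  have hq0 : q = 0 := by
    by_contra h
    have : q * q < q * 1 := (ENNReal.mul_lt_mul_iff_right h (hq1.trans ENNReal.one_lt_top).ne).2 hq1
    rw [mul_one] at this
    exact absurd hqq (not_le.2 this)
  have h1 : M (G 1)ᶜ = 0 := le_antisymm (hq0 ▸ hqle 1 zero_lt_one) bot_le
  have : ∀ᵐ y ∂M, y ∈ G 1 := by rw [ae_iff]; exact h1
  filter_upwards [this] with y hy
  simpa [hG] using hy

end

/-! ### Exchanging powers of lengths for powers of the level -/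

section
variable {E : Type*} {m : ℕ} {c : Fin m → E → ℝ} {l : Fin m → ℝ} {L : ℝ}

theorem casc_congr {c' : Fin m → E → ℝ} {y : List (Fin m) → E}
    (h : ∀ w i, c i (y w) = c' i (y w)) (n : ℕ) (x : ℝ) :
    casc c l n x y = casc c' l n x y := by
  induction n generalizing x y with
  | zero => rfl
  | succ n ih =>
    rcases le_or_gt 1 x with hx | hx
    · rw [casc_of_one_le c l hx, casc_of_one_le c' l hx]
    · rw [casc_succ c l hx, casc_succ c' l hx]
      exact Finset.sum_congr rfl fun i _ => by rw [h, ih fun w j => h (i :: w) j]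

/-- Along a stopped word the factors `l i ^ t` multiply to the `t`-th power of its length, which is
at most `x` if the depth suffices to reach the line; an initial level `x ≥ 1` leaves the empty word,
of length one. -/
theorem casc_mul_rpow_le (hl : IsRatio l L) (hc : ∀ i e, 0 ≤ c i e) {t : ℝ} (ht : 0 ≤ t) {n : ℕ}
    {x : ℝ} (hn : L ^ n ≤ x) (y : List (Fin m) → E) :
    casc (fun i e => c i e * l i ^ t) l n x y ≤ x ^ t * casc c l n x y := by
  have hx0 : 0 < x := (pow_pos hl.pos n).trans_le hn
  rcases le_or_gt 1 x with hx | hx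
  · rw [casc_of_one_le _ l hx, casc_of_one_le c l hx, mul_one]
    exact Real.one_le_rpow hx ht
  induction n generalizing x y with
  | zero => rw [pow_zero] at hn; linarith
  | succ n ih =>
    rw [casc_succ _ l hx, casc_succ c l hx, Finset.mul_sum]
    refine Finset.sum_le_sum fun i _ => ?_
    have hli := hl.apply_pos i
    have key : casc (fun i e => c i e * l i ^ t) l n (x / l i) (fun v => y (i :: v)) ≤
        (x / l i) ^ t * casc c l n (x / l i) (fun v => y (i :: v)) := by
      rcases le_or_gt 1 (x / l i) with hx' | hx'
      · rw [casc_of_one_le _ l hx', casc_of_one_le c l hx', mul_one]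
        exact Real.one_le_rpow hx' ht
      · exact ih (hl.pow_le_div hn i) _ (div_pos hx0 hli) hx'
    calc _ ≤ c i (y []) * l i ^ t * ((x / l i) ^ t * casc c l n (x / l i) (fun v => y (i :: v))) :=
          mul_le_mul_of_nonneg_left key (mul_nonneg (hc _ _) (by positivity))
      _ = _ := by
          rw [Real.div_rpow hx0.le hli.le]
          have : l i ^ t ≠ 0 := (Real.rpow_pos_of_pos hli t).ne'
          field_simp

/-- Before its last letter a stopped word still has length greater than `x`, so its length is at
least `r x`. The hypothesis `r * x ≤ 1` accounts for the empty word. -/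
theorem casc_mul_rpow_ge (hl : ∀ i, 0 < l i) (hc : ∀ i e, 0 ≤ c i e) {t : ℝ} (ht : 0 ≤ t)
    {r : ℝ} (hr : 0 < r) (hrl : ∀ i, r ≤ l i) (n : ℕ) {x : ℝ} (hx0 : 0 < x) (hxr : r * x ≤ 1)
    (y : List (Fin m) → E) :
    casc c l n x y * (r * x) ^ t ≤ casc (fun i e => c i e * l i ^ t) l n x y := by
  have hone : (r * x) ^ t ≤ 1 := Real.rpow_le_one (by positivity) hxr ht
  induction n generalizing x y with
  | zero => simpa using hone
  | succ n ih =>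
    rcases le_or_gt 1 x with hx | hx
    · rw [casc_of_one_le c l hx, casc_of_one_le _ l hx, one_mul]; exact hone
    · rw [casc_succ c l hx, casc_succ _ l hx, Finset.sum_mul]
      refine Finset.sum_le_sum fun i _ => ?_
      have hli := hl i
      have h1 : r * (x / l i) ≤ 1 := by
        rw [← mul_div_assoc, div_le_one hli]
        exact (mul_le_of_le_one_right hr.le hx.le).trans (hrl i)
      have key := ih (div_pos hx0 hli) h1 (fun v => y (i :: v))
        (Real.rpow_le_one (by positivity) h1 ht)
      calc _ = c i (y []) * l i ^ t * (casc c l n (x / l i) (fun v => y (i :: v)) *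
            (r * (x / l i)) ^ t) := by
            rw [← mul_div_assoc, Real.div_rpow (by positivity) hli.le]
            have : l i ^ t ≠ 0 := (Real.rpow_pos_of_pos hli t).ne'
            field_simp
        _ ≤ _ := mul_le_mul_of_nonneg_left key (mul_nonneg (hc _ _) (by positivity))

theorem casc_eq_one {y : List (Fin m) → E} (h : ∀ w, ∑ i, c i (y w) = 1) (n : ℕ) (x : ℝ) :
    casc c l n x y = 1 := by
  induction n generalizing x y with
  | zero => rfl
  | succ n ih =>
    rcases le_or_gt 1 x with hx | hx
    · rw [casc_of_one_le c l hx]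
    · rw [casc_succ c l hx]
      simp_rw [ih fun w => h (_ :: w), mul_one]
      exact h []

end

/-- Number of elements of the stopping line. -/
theorem casc_one_mul_le {E : Type*} {m : ℕ} {l : Fin m → ℝ} (hl : ∀ i, 0 < l i)
    (hsum : ∑ i, l i = 1) {r : ℝ} (hr : 0 < r) (hrl : ∀ i, r ≤ l i) (n : ℕ) {x : ℝ} (hx0 : 0 < x)
    (hxr : r * x ≤ 1) (y : List (Fin m) → E) :
    casc (fun (_ : Fin m) (_ : E) => (1 : ℝ)) l n x y * (r * x) ≤ 1 := by
  -- The lengths of the stopped words add up to one, and each is at least `r x`.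
  have h := casc_mul_rpow_ge (c := fun (_ : Fin m) (_ : E) => (1 : ℝ)) hl
    (fun _ _ => zero_le_one) zero_le_one hr hrl n hx0 hxr y
  rw [Real.rpow_one] at h
  exact h.trans (casc_eq_one (by simpa using hsum) n x).le

/-! ### Geometry of the rectangles -/

section
variable {m : ℕ} {b : Fin (m + 1) → ℝ}

/-- The values `y 0 = 0`, `y 1, …, y m = 1` all lie in the unit interval. -/
structure IsProfile (y : Fin (m + 1) → ℝ) : Prop where
  zero : y 0 = 0
  last : y (Fin.last m) = 1
  mem : ∀ j, y j ∈ Set.Icc (0 : ℝ) 1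

theorem sum_succ_sub_castSucc (f : Fin (m + 1) → ℝ) :
    ∑ i : Fin m, (f i.succ - f i.castSucc) = f (Fin.last m) - f 0 := by
  induction m with
  | zero => simp
  | succ m ih =>
    rw [Fin.sum_univ_castSucc]
    have := ih fun j => f j.castSucc
    simp only [Fin.succ_castSucc] at this ⊢
    rw [this]
    simp

/-- The union of the rectangles of generation `n`. -/
def levelSet (b : Fin (m + 1) → ℝ) (y : List (Fin m) → Fin (m + 1) → ℝ) (n : ℕ) : Set (ℝ × ℝ) :=
  ⋃ ω : List (Fin m), ⋃ _ : ω.length = n, rect b y ω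

theorem levelSet_zero (y : List (Fin m) → Fin (m + 1) → ℝ) :
    levelSet b y 0 = Set.Icc (0 : ℝ) 1 ×ˢ Set.Icc (0 : ℝ) 1 := by
  simp [levelSet, List.length_eq_zero_iff, rect, affComp]

theorem levelSet_succ (y : List (Fin m) → Fin (m + 1) → ℝ) (n : ℕ) :
    levelSet b y (n + 1) = ⋃ i, affMap b (y []) i '' levelSet b (fun v => y (i :: v)) n := by
  ext p
  simp only [levelSet, Set.mem_iUnion, exists_prop, rect, Set.image_iUnion]
  constructor
  · rintro ⟨w, hw, hp⟩
    cases w with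
    | nil => simp at hw
    | cons i v =>
      refine ⟨i, v, by simpa using hw, ?_⟩
      rw [affComp, Set.image_comp] at hp
      exact hp
  · rintro ⟨i, v, hv, hp⟩
    refine ⟨i :: v, by simpa using hv, ?_⟩
    rw [affComp, Set.image_comp]
    exact hp

theorem affMap_zero (y : Fin (m + 1) → ℝ) (i : Fin m) :
    affMap b y i (0, 0) = (b i.castSucc, y i.castSucc) := by simp [affMap]

theorem affMap_one (y : Fin (m + 1) → ℝ) (i : Fin m) :
    affMap b y i (1, 1) = (b i.succ, y i.succ) := by simp [affMap]

theorem convex_comb_mem {s t u : ℝ} (hs : s ∈ Set.Icc (0 : ℝ) 1) (ht : t ∈ Set.Icc (0 : ℝ) 1)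
    (hu : u ∈ Set.Icc (0 : ℝ) 1) : (t - s) * u + s ∈ Set.Icc (0 : ℝ) 1 := by
  obtain ⟨hs0, hs1⟩ := hs
  obtain ⟨ht0, ht1⟩ := ht
  obtain ⟨hu0, hu1⟩ := hu
  constructor <;> nlinarith [mul_nonneg ht0 hu0, mul_nonneg hs0 (sub_nonneg.2 hu1),
    mul_nonneg (sub_nonneg.2 ht1) hu0, mul_nonneg (sub_nonneg.2 hs1) (sub_nonneg.2 hu1)]

theorem affMap_mem_square {y : Fin (m + 1) → ℝ} (hb : IsProfile b) (hy : IsProfile y) (i : Fin m)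
    {p : ℝ × ℝ} (hp : p ∈ Set.Icc (0 : ℝ) 1 ×ˢ Set.Icc (0 : ℝ) 1) :
    affMap b y i p ∈ Set.Icc (0 : ℝ) 1 ×ˢ Set.Icc (0 : ℝ) 1 :=
  ⟨convex_comb_mem (hb.mem _) (hb.mem _) hp.1, convex_comb_mem (hy.mem _) (hy.mem _) hp.2⟩

theorem levelSet_subset_square (hb : IsProfile b) {y : List (Fin m) → Fin (m + 1) → ℝ}
    (hy : ∀ w, IsProfile (y w)) (n : ℕ) :
    levelSet b y n ⊆ Set.Icc (0 : ℝ) 1 ×ˢ Set.Icc (0 : ℝ) 1 := by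
  induction n generalizing y with
  | zero => rw [levelSet_zero]
  | succ n ih =>
    rw [levelSet_succ]
    refine Set.iUnion_subset fun i => ?_
    rintro _ ⟨p, hp, rfl⟩
    exact affMap_mem_square hb (hy []) i (ih (fun w => hy (i :: w)) hp)

theorem levelSet_succ_subset (hb : IsProfile b) {y : List (Fin m) → Fin (m + 1) → ℝ}
    (hy : ∀ w, IsProfile (y w)) (n : ℕ) : levelSet b y (n + 1) ⊆ levelSet b y n := by
  induction n generalizing y with
  | zero => rw [levelSet_zero]; exact levelSet_subset_square hb hy 1
  | succ n ih =>
    rw [levelSet_succ, levelSet_succ y n]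
    exact Set.iUnion_mono fun i => Set.image_mono (ih fun w => hy (i :: w))

/-- Profiles run from `0` to `1`, so the first map fixes `(0, 0)` and the last fixes `(1, 1)`. -/
theorem corners_mem_levelSet (hm : 0 < m) (hb : IsProfile b)
    {y : List (Fin m) → Fin (m + 1) → ℝ} (hy : ∀ w, IsProfile (y w)) (n : ℕ) :
    ((0 : ℝ), (0 : ℝ)) ∈ levelSet b y n ∧ ((1 : ℝ), (1 : ℝ)) ∈ levelSet b y n := by
  induction n generalizing y with
  | zero => rw [levelSet_zero]; simp
  | succ n ih =>
    rw [levelSet_succ]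
    refine ⟨Set.mem_iUnion.2 ⟨⟨0, hm⟩, _, (ih fun w => hy (_ :: w)).1, ?_⟩,
      Set.mem_iUnion.2 ⟨⟨m - 1, by lia⟩, _, (ih fun w => hy (_ :: w)).2, ?_⟩⟩
    · rw [affMap_zero]
      have : (⟨0, hm⟩ : Fin m).castSucc = 0 := by ext; rfl
      rw [this, hb.zero, (hy []).zero]
    · rw [affMap_one]
      have : (⟨m - 1, by lia⟩ : Fin m).succ = Fin.last m := by ext; simp; lia
      rw [this, hb.last, (hy []).last]

/-- The hypothesis on `p` ranges over all trees so that it passes to subtrees. For the two corners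
it puts the images of `(0, 0)` and `(1, 1)` under every composition into `Γ`. -/
theorem affComp_mem_levelSet (hb : IsProfile b)
    {y : List (Fin m) → Fin (m + 1) → ℝ} (hy : ∀ w, IsProfile (y w)) {p : ℝ × ℝ}
    (hp : ∀ y : List (Fin m) → Fin (m + 1) → ℝ, (∀ w, IsProfile (y w)) →
      ∀ n, p ∈ levelSet b y n) (w : List (Fin m)) (n : ℕ) :
    affComp b y w p ∈ levelSet b y n := by
  induction w generalizing y n with
  | nil => exact hp y hy n
  | cons i v ih =>
    have hmem := ih fun w => hy (i :: w)
    cases n with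
    | zero =>
      rw [levelSet_zero]
      exact affMap_mem_square hb (hy []) i (levelSet_subset_square hb (fun w => hy (i :: w)) 0
        (hmem 0))
    | succ n =>
      rw [levelSet_succ]
      exact Set.mem_iUnion.2 ⟨i, _, hmem n, rfl⟩

theorem limitSet_eq (y : List (Fin m) → Fin (m + 1) → ℝ) :
    limitSet b y = ⋂ n, levelSet b y n := rfl

end

/-! ### Upper bound for the covering number -/

section
variable {m : ℕ} {b : Fin (m + 1) → ℝ} {L : ℝ}

theorem exists_cover_rectangle {w h u₀ v₀ δ : ℝ} (hw : 0 ≤ w) (hδ : 0 < δ) (hwδ : w ≤ δ) :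
    ∃ A : Finset (ℝ × ℝ), (A.card : ℝ) ≤ |h| / δ + 1 ∧
      (fun p : ℝ × ℝ => (w * p.1 + u₀, h * p.2 + v₀)) '' (Set.Icc 0 1 ×ˢ Set.Icc 0 1) ⊆
        ⋃ a ∈ A, square a δ := by
  classical
  -- The height of the lower edge for either sign of `h`; the maps may reverse the vertical
  -- orientation.
  set v₁ := min v₀ (h + v₀) with hv₁
  refine ⟨(Finset.range (⌊|h| / δ⌋₊ + 1)).image fun k : ℕ => (u₀, v₁ + k * δ), ?_, ?_⟩
  · calc _ ≤ ((⌊|h| / δ⌋₊ + 1 : ℕ) : ℝ) := by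
          exact_mod_cast Finset.card_image_le.trans_eq (Finset.card_range _)
      _ ≤ _ := by push_cast; gcongr; exact Nat.floor_le (by positivity)
  · rintro _ ⟨⟨u, v⟩, ⟨⟨hu0, hu1⟩, hv0, hv1⟩, rfl⟩
    simp only at hu0 hu1 hv0 hv1
    set t := h * v + v₀ - v₁ with ht
    have ht0 : 0 ≤ t ∧ t ≤ |h| := by
      rcases le_or_gt 0 h with hh | hh
      · rw [ht, hv₁, min_eq_left (by linarith), abs_of_nonneg hh]
        constructor <;> nlinarith
      · rw [ht, hv₁, min_eq_right (by linarith), abs_of_neg hh]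
        constructor <;> nlinarith
    have hk0 := Nat.floor_le (div_nonneg ht0.1 hδ.le)
    have hk1 := Nat.lt_floor_add_one (t / δ)
    rw [le_div_iff₀ hδ] at hk0
    rw [div_lt_iff₀ hδ] at hk1
    simp only [Set.mem_iUnion, Finset.mem_image, Finset.mem_range, exists_prop]
    refine ⟨_, ⟨⌊t / δ⌋₊, ?_, rfl⟩, ⟨?_, ?_⟩, ?_, ?_⟩
    · exact Nat.lt_succ_of_le (Nat.floor_le_floor (by gcongr; exact ht0.2))
    · simp only; nlinarith
    · simp only; nlinarith
    · simp only; linarith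
    · simp only; linarith

/-- Each stopped rectangle receives one column of squares. The outer affine map makes the induction
possible: a child replaces `w` and `x` by `w * len b i` and `x / len b i`, leaving the side `w * x`
unchanged. -/
theorem exists_cover_levelSet (hb : IsProfile b) (hl : IsRatio (len b) L)
    {y : List (Fin m) → Fin (m + 1) → ℝ} (hy : ∀ w, IsProfile (y w)) {n : ℕ} {x w h u₀ v₀ : ℝ}
    (hw : 0 < w) (hn : L ^ n ≤ x) :
    ∃ A : Finset (ℝ × ℝ), (A.card : ℝ) ≤ |h| / (w * x) * casc (fun i e => ratio e i) (len b) n x y +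
        casc (fun _ _ => (1 : ℝ)) (len b) n x y ∧
      (fun p : ℝ × ℝ => (w * p.1 + u₀, h * p.2 + v₀)) '' levelSet b y n ⊆
        ⋃ a ∈ A, square a (w * x) := by
  classical
  have hx0 : 0 < x := (pow_pos hl.pos n).trans_le hn
  rcases le_or_gt 1 x with hx | hx
  · simp only [casc_of_one_le _ (len b) hx, mul_one]
    obtain ⟨A, hA, hcov⟩ := exists_cover_rectangle (h := h) (u₀ := u₀) (v₀ := v₀) hw.le
      (mul_pos hw hx0) (le_mul_of_one_le_right hw.le hx)
    exact ⟨A, hA, (Set.image_mono (levelSet_subset_square hb hy n)).trans hcov⟩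
  induction n generalizing y x w h u₀ v₀ with
  | zero => rw [pow_zero] at hn; linarith
  | succ n ih =>
    have hex : ∀ i : Fin m, ∃ A : Finset (ℝ × ℝ), (A.card : ℝ) ≤ |h| / (w * x) *
        (ratio (y []) i * casc (fun i e => ratio e i) (len b) n (x / len b i) (fun v => y (i :: v))) +
        1 * casc (fun _ _ => (1 : ℝ)) (len b) n (x / len b i) (fun v => y (i :: v)) ∧
      (fun p : ℝ × ℝ => (w * p.1 + u₀, h * p.2 + v₀)) ''
        (affMap b (y []) i '' levelSet b (fun v => y (i :: v)) n) ⊆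
        ⋃ a ∈ A, square a (w * x) := by
      intro i
      have hli := hl.apply_pos i
      have hδ : w * len b i * (x / len b i) = w * x := by field_simp
      have himg : (fun p : ℝ × ℝ => (w * p.1 + u₀, h * p.2 + v₀)) ''
          (affMap b (y []) i '' levelSet b (fun v => y (i :: v)) n) =
          (fun p : ℝ × ℝ => (w * len b i * p.1 + (w * b i.castSucc + u₀),
            h * (y [] i.succ - y [] i.castSucc) * p.2 + (h * y [] i.castSucc + v₀))) ''
            levelSet b (fun v => y (i :: v)) n := by
        rw [Set.image_image]
        refine Set.image_congr fun p _ => ?_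
        simp only [affMap, len]
        ext <;> simp only <;> ring
      have hcard : |h * (y [] i.succ - y [] i.castSucc)| / (w * x) =
          |h| / (w * x) * ratio (y []) i := by rw [abs_mul, ratio]; ring
      rw [himg, ← mul_assoc, ← hcard, one_mul, ← hδ]
      have hn' := hl.pow_le_div hn i
      rcases le_or_gt 1 (x / len b i) with hx' | hx'
      · simp only [casc_of_one_le _ (len b) hx', mul_one]
        obtain ⟨A, hA, hcov⟩ := exists_cover_rectangle
          (h := h * (y [] i.succ - y [] i.castSucc)) (u₀ := w * b i.castSucc + u₀)
          (v₀ := h * y [] i.castSucc + v₀) (mul_pos hw hli).le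
          (mul_pos (mul_pos hw hli) (div_pos hx0 hli))
          (le_mul_of_one_le_right (mul_pos hw hli).le hx')
        exact ⟨A, hA, (Set.image_mono (levelSet_subset_square hb (fun v => hy (i :: v)) n)).trans
          hcov⟩
      · exact ih (fun v => hy (i :: v)) (mul_pos hw hli) hn' (div_pos hx0 hli) hx'
    choose A hA hcov using hex
    refine ⟨Finset.univ.biUnion A, ?_, ?_⟩
    · rw [casc_succ _ _ hx, casc_succ _ _ hx, Finset.mul_sum, ← Finset.sum_add_distrib]
      calc ((Finset.univ.biUnion A).card : ℝ) ≤ ∑ i, ((A i).card : ℝ) := by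
            exact_mod_cast Finset.card_biUnion_le
        _ ≤ _ := Finset.sum_le_sum fun i _ => hA i
    · rw [levelSet_succ, Set.image_iUnion]
      refine Set.iUnion_subset fun i => (hcov i).trans ?_
      refine Set.biUnion_subset_biUnion_left fun a ha => ?_
      exact Finset.mem_biUnion.2 ⟨i, Finset.mem_univ _, ha⟩

end

/-! ### Lower bound for the covering number -/

/-- The length of the part of the interval `[a, a + r]` to the left of `t`. -/
noncomputable def clampLen (a r t : ℝ) : ℝ := max 0 (min (t - a) r)

theorem clampLen_mono (a r : ℝ) : Monotone (clampLen a r) := fun s t h =>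
  max_le_max le_rfl (min_le_min (by linarith) le_rfl)

theorem clampLen_sub_le {a r : ℝ} (hr : 0 ≤ r) (s t : ℝ) : clampLen a r t - clampLen a r s ≤ r := by
  have h1 : clampLen a r t ≤ r := max_le hr (min_le_right _ _)
  have h2 : 0 ≤ clampLen a r s := le_max_left _ _
  linarith

theorem clampLen_of_mem {a r t : ℝ} (h0 : a ≤ t) (h1 : t ≤ a + r) : clampLen a r t = t - a := by
  rw [clampLen, min_eq_left (by linarith), max_eq_right (by linarith)]

/-- A cover of a graph over an interval by squares of side `δ` has at least (height)/`δ` squares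
that meet the interval. -/
theorem abs_sub_le_card_mul {f : ℝ → ℝ} (hf : Continuous f) {A : Finset (ℝ × ℝ)} {δ u u' : ℝ}
    (hu : u ≤ u') (hA : ∀ t ∈ Set.Icc u u', ∃ a ∈ A, (t, f t) ∈ square a δ) :
    |f u' - f u| ≤ A.card * δ := by
  have hδ : 0 ≤ δ := by
    obtain ⟨a, -, h, -⟩ := hA u (Set.left_mem_Icc.2 hu)
    have := h.1.trans h.2
    linarith
  have hsub : Set.uIcc (f u) (f u') ⊆ ⋃ a ∈ A, Set.Icc a.2 (a.2 + δ) := by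
    refine (intermediate_value_uIcc hf.continuousOn).trans ?_
    rintro _ ⟨t, ht, rfl⟩
    rw [Set.uIcc_of_le hu] at ht
    obtain ⟨a, ha, h⟩ := hA t ht
    exact Set.mem_biUnion ha h.2
  have hvol := (measure_mono hsub).trans (measure_biUnion_finset_le (μ := volume) A _)
  rw [Real.volume_interval] at hvol
  simp only [Real.volume_Icc, add_sub_cancel_left, Finset.sum_const, nsmul_eq_mul] at hvol
  rw [← ENNReal.ofReal_natCast, ← ENNReal.ofReal_mul (Nat.cast_nonneg _)] at hvol
  exact (ENNReal.ofReal_le_ofReal_iff (by positivity)).1 hvol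

/-- Since `w ≤ δ`, a square that meets the strip over `[u₀, u₀ + w]` has this whole interval inside
its enlarged base of length `3 * δ`, and so contributes exactly `w ≥ r δ`. Written as an increment
of a monotone function, the bound telescopes over adjacent intervals. -/
theorem mul_abs_sub_le_clampLen {r : ℝ} {f : ℝ → ℝ} (hf : Continuous f)
    {A : Finset (ℝ × ℝ)} {δ w u₀ : ℝ} (hr : 0 < r) (hw : 0 < w) (hwδ : w ≤ δ) (hrw : r * δ ≤ w)
    (hA : ∀ t ∈ Set.Icc u₀ (w + u₀), ∃ a ∈ A, (t, f t) ∈ square a δ) :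
    r * |f (w + u₀) - f u₀| ≤
      ∑ a ∈ A, clampLen (a.1 - δ) (3 * δ) (w + u₀) - ∑ a ∈ A, clampLen (a.1 - δ) (3 * δ) u₀ := by
  classical
  set B := A.filter fun a => ∃ t ∈ Set.Icc u₀ (w + u₀), (t, f t) ∈ square a δ with hB
  have hcard : |f (w + u₀) - f u₀| ≤ B.card * δ := by
    refine abs_sub_le_card_mul hf (by linarith) fun t ht => ?_
    obtain ⟨a, ha, hat⟩ := hA t ht
    exact ⟨a, Finset.mem_filter.2 ⟨ha, t, ht, hat⟩, hat⟩
  rw [← Finset.sum_sub_distrib]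
  calc r * |f (w + u₀) - f u₀| ≤ r * (B.card * δ) := by gcongr
    _ = B.card * (r * δ) := by ring
    _ ≤ B.card * w := by gcongr
    _ = ∑ a ∈ B, w := by simp
    _ = ∑ a ∈ B, (clampLen (a.1 - δ) (3 * δ) (w + u₀) - clampLen (a.1 - δ) (3 * δ) u₀) := by
        refine Finset.sum_congr rfl fun a ha => ?_
        obtain ⟨-, t, ht, hat, -⟩ := Finset.mem_filter.1 ha
        obtain ⟨h1, h2⟩ := ht
        obtain ⟨h3, h4⟩ := hat
        simp only at h3 h4
        rw [clampLen_of_mem (by linarith) (by linarith),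
          clampLen_of_mem (by linarith) (by linarith)]
        ring
    _ ≤ _ := Finset.sum_le_sum_of_subset_of_nonneg (Finset.filter_subset _ _)
        fun a _ _ => sub_nonneg.2 (clampLen_mono _ _ (by linarith))

section
variable {m : ℕ} {b : Fin (m + 1) → ℝ} {L : ℝ}

/-- Every stopped rectangle has two opposite corners on the graph of `f`, so its height is a
variation of `f` over its base. The increments over the bases telescope along the partition. -/
theorem mul_casc_le_clampLen (hb : IsProfile b) (hl : IsRatio (len b) L)
    {r : ℝ} (hr : 0 < r) (hrl : ∀ i, r ≤ len b i) {f : ℝ → ℝ} (hf : Continuous f)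
    {A : Finset (ℝ × ℝ)} {δ : ℝ} (hA : ∀ t ∈ Set.Icc (0 : ℝ) 1, ∃ a ∈ A, (t, f t) ∈ square a δ)
    {n : ℕ} {y : List (Fin m) → Fin (m + 1) → ℝ} {x w h u₀ v₀ : ℝ} (hw : 0 < w) (hu₀ : 0 ≤ u₀)
    (hu₁ : w + u₀ ≤ 1) (hδ : w * x = δ) (hn : L ^ n ≤ x) (hrw : r * δ ≤ w)
    (hf0 : ∀ v, f (w * (affComp b y v (0, 0)).1 + u₀) = h * (affComp b y v (0, 0)).2 + v₀)
    (hf1 : ∀ v, f (w * (affComp b y v (1, 1)).1 + u₀) = h * (affComp b y v (1, 1)).2 + v₀) :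
    r * (|h| * casc (fun i e => ratio e i) (len b) n x y) ≤
      ∑ a ∈ A, clampLen (a.1 - δ) (3 * δ) (w + u₀) - ∑ a ∈ A, clampLen (a.1 - δ) (3 * δ) u₀ := by
  have hx0 : 0 < x := (pow_pos hl.pos n).trans_le hn
  have h0 := hf0 []
  have h1 := hf1 []
  simp only [affComp, id_eq, mul_zero, mul_one, zero_add] at h0 h1
  induction n generalizing y x w h u₀ v₀ with
  | zero =>
    rw [pow_zero] at hn
    rw [casc_zero, mul_one]
    have := mul_abs_sub_le_clampLen hf hr hw (hδ ▸ le_mul_of_one_le_right hw.le hn) hrw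
      fun t ht => hA t ⟨hu₀.trans ht.1, ht.2.trans hu₁⟩
    rwa [h0, h1, add_sub_cancel_right] at this
  | succ n ih =>
    rcases le_or_gt 1 x with hx | hx
    · rw [casc_of_one_le _ _ hx, mul_one]
      have := mul_abs_sub_le_clampLen hf hr hw (hδ ▸ le_mul_of_one_le_right hw.le hx) hrw
        fun t ht => hA t ⟨hu₀.trans ht.1, ht.2.trans hu₁⟩
      rwa [h0, h1, add_sub_cancel_right] at this
    · set Φ : ℝ → ℝ := fun t => ∑ a ∈ A, clampLen (a.1 - δ) (3 * δ) t with hΦ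
      have hstep : ∀ i : Fin m, r * (|h| * (ratio (y []) i *
          casc (fun i e => ratio e i) (len b) n (x / len b i) (fun v => y (i :: v)))) ≤
          Φ (w * b i.succ + u₀) - Φ (w * b i.castSucc + u₀) := by
        intro i
        have hli := hl.apply_pos i
        have hend : w * len b i + (w * b i.castSucc + u₀) = w * b i.succ + u₀ := by
          rw [len]; ring
        have hfi : ∀ p v, f (w * (affComp b y (i :: v) p).1 + u₀) =
            h * (affComp b y (i :: v) p).2 + v₀ →
            f (w * len b i * (affComp b (fun v => y (i :: v)) v p).1 + (w * b i.castSucc + u₀)) =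
            h * (y [] i.succ - y [] i.castSucc) * (affComp b (fun v => y (i :: v)) v p).2 +
              (h * y [] i.castSucc + v₀) := by
          intro p v hv
          simp only [affComp, Function.comp_apply, affMap] at hv
          convert hv using 1
          · congr 1; rw [len]; ring
          · ring
        have hf0' := fun v => hfi (0, 0) v (hf0 (i :: v))
        have hf1' := fun v => hfi (1, 1) v (hf1 (i :: v))
        have h0' := hf0' []
        have h1' := hf1' []
        simp only [affComp, id_eq, mul_zero, mul_one, zero_add] at h0' h1'
        have key := ih (y := fun v => y (i :: v)) (x := x / len b i) (w := w * len b i)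
          (h := h * (y [] i.succ - y [] i.castSucc)) (u₀ := w * b i.castSucc + u₀)
          (v₀ := h * y [] i.castSucc + v₀) (mul_pos hw hli)
          (add_nonneg (mul_nonneg hw.le (hb.mem _).1) hu₀)
          (by
            rw [hend]
            exact (add_le_add_left (mul_le_of_le_one_right hw.le (hb.mem _).2) u₀).trans hu₁)
          (by rw [← hδ]; field_simp) (hl.pow_le_div hn i)
          (by
            have : δ ≤ w := hδ ▸ mul_le_of_le_one_right hw.le hx.le
            rw [mul_comm w]
            exact mul_le_mul (hrl i) this (hδ ▸ (mul_pos hw hx0).le) hli.le)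
          hf0' hf1' (div_pos hx0 hli) h0' h1'
        rw [hend, abs_mul] at key
        rw [← mul_assoc |h|]
        exact key
      rw [casc_succ _ _ hx, Finset.mul_sum, Finset.mul_sum]
      refine (Finset.sum_le_sum fun i _ => hstep i).trans ?_
      rw [sum_succ_sub_castSucc fun j => Φ (w * b j + u₀), hb.last, hb.zero, mul_one, mul_zero,
        zero_add]

/-- The covering number of a graph through all corner points is at least a multiple of the total
height of the stopping line. -/
theorem mul_casc_le_card (hb : IsProfile b) (hl : IsRatio (len b) L)
    {r : ℝ} (hr : 0 < r) (hrl : ∀ i, r ≤ len b i) {f : ℝ → ℝ} (hf : Continuous f)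
    {A : Finset (ℝ × ℝ)} {δ : ℝ} (hδ : 0 < δ) (hrδ : r * δ ≤ 1)
    (hA : ∀ t ∈ Set.Icc (0 : ℝ) 1, ∃ a ∈ A, (t, f t) ∈ square a δ)
    {n : ℕ} {y : List (Fin m) → Fin (m + 1) → ℝ} (hn : L ^ n ≤ δ)
    (hf0 : ∀ v, f (affComp b y v (0, 0)).1 = (affComp b y v (0, 0)).2)
    (hf1 : ∀ v, f (affComp b y v (1, 1)).1 = (affComp b y v (1, 1)).2) :
    r * casc (fun i e => ratio e i) (len b) n δ y ≤ 3 * δ * A.card := by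
  have key := mul_casc_le_clampLen (h := 1) (w := 1) (u₀ := 0) (v₀ := 0) hb hl hr hrl hf hA one_pos
    le_rfl (by simp) (one_mul δ) hn hrδ (by simpa using hf0) (by simpa using hf1)
  rw [abs_one, one_mul, ← Finset.sum_sub_distrib] at key
  calc _ ≤ _ := key
    _ ≤ ∑ a ∈ A, 3 * δ := Finset.sum_le_sum fun a _ => clampLen_sub_le (by positivity) _ _
    _ = _ := by simp; ring

end

/-! ### The limit set as the graph of a continuous function -/

section
variable {m : ℕ} {b : Fin (m + 1) → ℝ}

/-- The height of the rectangle of a word. -/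
def wordHeight : (List (Fin m) → Fin (m + 1) → ℝ) → List (Fin m) → ℝ
  | _, [] => 1
  | y, i :: w => ratio (y []) i * wordHeight (fun v => y (i :: v)) w

/-- Two rectangles over one abscissa are equal or are neighbours with a common corner on their
common vertical line. Hence `2 * M`, and hence the two edge statements, which measure the distance
to that corner and enter the induction. The factor `h` accumulates the signed heights. -/
theorem levelSet_fibre_le (hbm : StrictMono b) (hb : IsProfile b)
    {y : List (Fin m) → Fin (m + 1) → ℝ} (hy : ∀ w, IsProfile (y w)) {n : ℕ} {h M : ℝ}
    (hM : ∀ w : List (Fin m), w.length = n → |h| * wordHeight y w ≤ M) :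
    (∀ p ∈ levelSet b y n, ∀ q ∈ levelSet b y n, p.1 = q.1 → |h * (p.2 - q.2)| ≤ 2 * M) ∧
    (∀ p ∈ levelSet b y n, p.1 = 0 → |h * p.2| ≤ M) ∧
    (∀ p ∈ levelSet b y n, p.1 = 1 → |h * (p.2 - 1)| ≤ M) := by
  induction n generalizing y h M with
  | zero =>
    have hM' : |h| ≤ M := by simpa [wordHeight] using hM [] rfl
    have hM0 : 0 ≤ M := (abs_nonneg h).trans hM'
    have aux : ∀ t : ℝ, |t| ≤ 1 → |h * t| ≤ M := fun t ht => by
      rw [abs_mul]; exact (mul_le_of_le_one_right (abs_nonneg h) ht).trans hM'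
    rw [levelSet_zero]
    refine ⟨?_, ?_, ?_⟩
    · rintro p ⟨-, hp0, hp1⟩ q ⟨-, hq0, hq1⟩ -
      exact (aux _ (abs_le.2 ⟨by linarith, by linarith⟩)).trans (by linarith)
    · rintro p ⟨-, hp0, hp1⟩ -
      exact aux _ (abs_le.2 ⟨by linarith, by linarith⟩)
    · rintro p ⟨-, hp0, hp1⟩ -
      exact aux _ (abs_le.2 ⟨by linarith, by linarith⟩)
  | succ n ih =>
    have ih' := fun i : Fin m => ih (y := fun v => y (i :: v)) (fun v => hy (i :: v))
      (h := h * (y [] i.succ - y [] i.castSucc)) (M := M) (fun w hw => by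
        have := hM (i :: w) (by simpa using hw)
        rwa [wordHeight, ratio, ← mul_assoc, ← abs_mul] at this)
    have hsq : ∀ i : Fin m, levelSet b (fun v => y (i :: v)) n ⊆
        Set.Icc (0 : ℝ) 1 ×ˢ Set.Icc (0 : ℝ) 1 := fun i =>
      levelSet_subset_square hb (fun v => hy (i :: v)) n
    have hlen : ∀ i : Fin m, 0 < b i.succ - b i.castSucc := fun i =>
      sub_pos.2 (hbm Fin.castSucc_lt_succ)
    have hleft : ∀ (i : Fin m), ∀ p ∈ levelSet b (fun v => y (i :: v)) n,
        b i.castSucc ≤ (affMap b (y []) i p).1 ∧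
          ((affMap b (y []) i p).1 = b i.castSucc → p.1 = 0) := fun i p hp => by
      have h0 := (hsq i hp).1.1
      refine ⟨?_, fun he => ?_⟩
      · simpa [affMap] using mul_nonneg (hlen i).le h0
      · simpa [affMap, (hlen i).ne'] using he
    have hright : ∀ (i : Fin m), ∀ p ∈ levelSet b (fun v => y (i :: v)) n,
        (affMap b (y []) i p).1 ≤ b i.succ ∧
          ((affMap b (y []) i p).1 = b i.succ → p.1 = 1) := fun i p hp => by
      have h1 := (hsq i hp).1.2
      refine ⟨?_, fun he => ?_⟩
      · have := mul_le_of_le_one_right (hlen i).le h1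
        simp only [affMap]
        linarith
      · simp only [affMap] at he
        have : (b i.succ - b i.castSucc) * (p.1 - 1) = 0 := by linarith
        rcases mul_eq_zero.1 this with h | h
        · exact absurd h (hlen i).ne'
        · linarith
    have hlt : ∀ i j : Fin m, i < j → ∀ p ∈ levelSet b (fun v => y (i :: v)) n,
        ∀ q ∈ levelSet b (fun v => y (j :: v)) n,
        (affMap b (y []) i p).1 = (affMap b (y []) j q).1 →
        |h * ((affMap b (y []) i p).2 - (affMap b (y []) j q).2)| ≤ 2 * M := by
      intro i j hij p hp q hq he
      have hle : i.succ ≤ j.castSucc := Fin.succ_le_castSucc_iff.2 hij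
      have h1 := hright i p hp
      have h2 := hleft j q hq
      have h3 := hbm.monotone hle
      have hp1 := h1.2 (le_antisymm h1.1 (by linarith))
      have hq0 := h2.2 (le_antisymm (by linarith) h2.1)
      have hse : i.succ = j.castSucc := hbm.injective (le_antisymm h3 (by linarith))
      have e : h * ((affMap b (y []) i p).2 - (affMap b (y []) j q).2) =
          h * (y [] i.succ - y [] i.castSucc) * (p.2 - 1) -
            h * (y [] j.succ - y [] j.castSucc) * q.2 := by
        simp only [affMap, ← hse]; ring
      rw [e, two_mul]
      exact (abs_sub _ _).trans (add_le_add ((ih' i).2.2 p hp hp1) ((ih' j).2.1 q hq hq0))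
    rw [levelSet_succ]
    refine ⟨?_, ?_, ?_⟩
    · intro p hp q hq he
      obtain ⟨i, p, hp', rfl⟩ := Set.mem_iUnion.1 hp
      obtain ⟨j, q, hq', rfl⟩ := Set.mem_iUnion.1 hq
      rcases lt_trichotomy i j with hij | rfl | hij
      · exact hlt i j hij p hp' q hq' he
      · have hpq : p.1 = q.1 := by
          simpa [affMap, (hlen i).ne'] using he
        have := (ih' i).1 p hp' q hq' hpq
        convert this using 2
        simp only [affMap]; ring
      · rw [← abs_neg, ← mul_neg, neg_sub]
        exact hlt j i hij q hq' p hp' he.symm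
    · intro p hp h0
      obtain ⟨i, p, hp', rfl⟩ := Set.mem_iUnion.1 hp
      have h1 := hleft i p hp'
      have h2 : 0 ≤ b i.castSucc := (hb.mem _).1
      have hp0 := h1.2 (by linarith [h1.1])
      have hi : i.castSucc = 0 := hbm.injective (by rw [hb.zero]; linarith [h1.1])
      have := (ih' i).2.1 p hp' hp0
      simpa [affMap, hi, (hy []).zero, mul_assoc] using this
    · intro p hp h0
      obtain ⟨i, p, hp', rfl⟩ := Set.mem_iUnion.1 hp
      have h1 := hright i p hp'
      have h2 : b i.succ ≤ 1 := (hb.mem _).2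
      have hp1 := h1.2 (by linarith [h1.1])
      have hi : i.succ = Fin.last m := hbm.injective (by rw [hb.last]; linarith [h1.1])
      have := (ih' i).2.2 p hp' hp1
      convert this using 2
      simp only [affMap, hi, (hy []).last]
      ring

theorem exists_mem_Icc_succ (hm : 0 < m) (hb : IsProfile b) {x : ℝ} (hx : x ∈ Set.Icc (0 : ℝ) 1) :
    ∃ i : Fin m, b i.castSucc ≤ x ∧ x ≤ b i.succ := by
  by_contra! hcon
  have : ∀ j : Fin (m + 1), b j ≤ x := fun j => by
    induction j using Fin.induction with
    | zero => rw [hb.zero]; exact hx.1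
    | succ i ih => exact (hcon i ih).le
  have h1 := hcon ⟨m - 1, by lia⟩ (this _)
  have h2 : (⟨m - 1, by lia⟩ : Fin m).succ = Fin.last m := by ext; simp; lia
  rw [h2, hb.last] at h1
  exact absurd hx.2 (not_le.2 h1)

theorem exists_mem_levelSet (hm : 0 < m) (hbm : StrictMono b) (hb : IsProfile b)
    (y : List (Fin m) → Fin (m + 1) → ℝ) (n : ℕ) {x : ℝ}
    (hx : x ∈ Set.Icc (0 : ℝ) 1) : ∃ v, (x, v) ∈ levelSet b y n := by
  induction n generalizing y x with
  | zero => exact ⟨0, by rw [levelSet_zero]; simpa using hx⟩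
  | succ n ih =>
    obtain ⟨i, h0, h1⟩ := exists_mem_Icc_succ hm hb hx
    have hlen : 0 < b i.succ - b i.castSucc := sub_pos.2 (hbm Fin.castSucc_lt_succ)
    obtain ⟨v, hv⟩ := ih (fun w => y (i :: w)) (x := (x - b i.castSucc) / (b i.succ - b i.castSucc))
      ⟨div_nonneg (by linarith) hlen.le, by rw [div_le_one hlen]; linarith⟩
    rw [levelSet_succ]
    refine ⟨_, Set.mem_iUnion.2 ⟨i, _, hv, Prod.ext ?_ rfl⟩⟩
    simp only [affMap]
    field_simp
    ring

theorem isCompact_levelSet (y : List (Fin m) → Fin (m + 1) → ℝ) (n : ℕ) :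
    IsCompact (levelSet b y n) := by
  induction n generalizing y with
  | zero => rw [levelSet_zero]; exact isCompact_Icc.prod isCompact_Icc
  | succ n ih =>
    rw [levelSet_succ]
    refine isCompact_iUnion fun i => (ih _).image ?_
    unfold affMap
    fun_prop

/-- If the heights of the rectangles tend to zero, the limit set is the graph of a continuous
function. -/
theorem exists_limitSet_eq_graph (hm : 0 < m) (hbm : StrictMono b) (hb : IsProfile b)
    {y : List (Fin m) → Fin (m + 1) → ℝ} (hy : ∀ w, IsProfile (y w))
    (hh : ∀ ε : ℝ, 0 < ε → ∃ n, ∀ w : List (Fin m), w.length = n → wordHeight y w ≤ ε) :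
    ∃ F : C(unitInterval, unitInterval), limitSet b y = graph F := by
  have hsub : limitSet b y ⊆ Set.Icc (0 : ℝ) 1 ×ˢ Set.Icc (0 : ℝ) 1 := by
    rw [limitSet_eq]
    exact (Set.iInter_subset _ 0).trans (levelSet_subset_square hb hy 0)
  have hcomp : IsCompact (limitSet b y) := by
    rw [limitSet_eq]
    exact (isCompact_levelSet y 0).of_isClosed_subset
      (isClosed_iInter fun n => (isCompact_levelSet y n).isClosed) (Set.iInter_subset _ 0)
  have hinj : ∀ p ∈ limitSet b y, ∀ q ∈ limitSet b y, p.1 = q.1 → p = q := by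
    intro p hp q hq he
    refine Prod.ext he (sub_eq_zero.1 (abs_eq_zero.1 (le_antisymm ?_ (abs_nonneg _))))
    refine le_of_forall_pos_le_add fun ε hε => ?_
    obtain ⟨n, hn⟩ := hh (ε / 2) (by positivity)
    rw [limitSet_eq, Set.mem_iInter] at hp hq
    have := (levelSet_fibre_le hbm hb hy (n := n) (h := 1) (M := ε / 2)
      (by simpa using hn)).1 p (hp n) q (hq n) he
    rw [one_mul] at this
    linarith
  have hsurj : ∀ x ∈ Set.Icc (0 : ℝ) 1, ∃ v, (x, v) ∈ limitSet b y := by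
    intro x hx
    -- The fibres of the level sets over `x` are nested, nonempty and compact.
    have hne := IsCompact.nonempty_iInter_of_sequence_nonempty_isCompact_isClosed
      (fun n => levelSet b y n ∩ Prod.fst ⁻¹' {x})
      (fun n => Set.inter_subset_inter_left _ (levelSet_succ_subset hb hy n))
      (fun n => by
        obtain ⟨v, hv⟩ := exists_mem_levelSet hm hbm hb y n hx
        exact ⟨_, hv, rfl⟩)
      ((isCompact_levelSet y 0).inter_right (isClosed_singleton.preimage continuous_fst))
      (fun n => (isCompact_levelSet y n).isClosed.inter
        (isClosed_singleton.preimage continuous_fst))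
    obtain ⟨⟨x', v⟩, hp⟩ := hne
    rw [Set.mem_iInter] at hp
    obtain rfl : x' = x := (hp 0).2
    exact ⟨v, by rw [limitSet_eq]; exact Set.mem_iInter.2 fun n => (hp n).1⟩
  have : CompactSpace (limitSet b y) := isCompact_iff_compactSpace.1 hcomp
  let π : limitSet b y → unitInterval := fun p => ⟨p.1.1, (hsub p.2).1⟩
  have hπ : Continuous π := by fun_prop
  have hbij : Function.Bijective π := by
    refine ⟨fun p q h => Subtype.ext (hinj p p.2 q q.2 (congrArg Subtype.val h)), fun x => ?_⟩
    obtain ⟨v, hv⟩ := hsurj x x.2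
    exact ⟨⟨_, hv⟩, rfl⟩
  -- A continuous bijection from a compact space to a Hausdorff space has a continuous inverse; its
  -- second coordinate is `F`.
  let e : limitSet b y ≃ₜ unitInterval :=
    Continuous.homeoOfEquivCompactToT2 (f := Equiv.ofBijective π hbij) hπ
  have he : ∀ p, e p = π p := fun _ => rfl
  refine ⟨⟨fun x => ⟨(e.symm x).1.2, (hsub (e.symm x).2).2⟩, by fun_prop⟩, ?_⟩
  ext p
  simp only [graph, Set.mem_range, ContinuousMap.coe_mk]
  have hx : ∀ x : unitInterval, (e.symm x).1.1 = x := fun x => by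
    have := he (e.symm x)
    rw [Homeomorph.apply_symm_apply] at this
    exact (congrArg Subtype.val this).symm
  constructor
  · intro hp
    refine ⟨π ⟨p, hp⟩, ?_⟩
    rw [← he, Homeomorph.symm_apply_apply, he]
  · rintro ⟨x, rfl⟩
    have : ((x : ℝ), (e.symm x).1.2) = (e.symm x).1 := Prod.ext (hx x).symm rfl
    rw [this]
    exact (e.symm x).2

/-- Level `0` never stops, so the right-hand side is a sum over the whole generation, of which the
left-hand side is one term. -/
theorem wordHeight_pow_le_casc (y : List (Fin m) → Fin (m + 1) → ℝ) (l : Fin m → ℝ) (p : ℕ)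
    (w : List (Fin m)) :
    wordHeight y w ^ p ≤ casc (fun i e => ratio e i ^ p) l w.length 0 y := by
  induction w generalizing y with
  | nil => simp [wordHeight]
  | cons i w ih =>
    have h0 : ∀ (i : Fin m) (e : Fin (m + 1) → ℝ), 0 ≤ ratio e i ^ p := fun i e =>
      pow_nonneg (abs_nonneg _) p
    rw [List.length_cons, casc_succ _ _ zero_lt_one, wordHeight, mul_pow]
    refine le_trans ?_ (Finset.single_le_sum (fun j _ => mul_nonneg (h0 j _)
      (casc_nonneg _ l h0 _ _ _)) (Finset.mem_univ i))
    rw [zero_div]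
    exact mul_le_mul_of_nonneg_left (ih _) (h0 i _)

end

/-! ### Covering numbers and passage to all small scales -/

theorem coverNumber_le_card {δ : ℝ} {E : Set (ℝ × ℝ)} {A : Finset (ℝ × ℝ)}
    (h : E ⊆ ⋃ a ∈ A, square a δ) : coverNumber δ E ≤ A.card :=
  Nat.sInf_le ⟨A, rfl, h⟩

/-- A finite cover has to be supplied, since `sInf ∅ = 0` would give an uncoverable set the covering
number zero. -/
theorem exists_card_eq_coverNumber {δ : ℝ} {E : Set (ℝ × ℝ)}
    (h : ∃ A : Finset (ℝ × ℝ), E ⊆ ⋃ a ∈ A, square a δ) :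
    ∃ A : Finset (ℝ × ℝ), A.card = coverNumber δ E ∧ E ⊆ ⋃ a ∈ A, square a δ := by
  obtain ⟨A, hA⟩ := h
  exact Nat.sInf_mem (s := {k : ℕ | ∃ A : Finset (ℝ × ℝ), A.card = k ∧ E ⊆ ⋃ a ∈ A, square a δ})
    ⟨_, A, rfl, hA⟩

theorem square_mono {a : ℝ × ℝ} {δ δ' : ℝ} (h : δ ≤ δ') : square a δ ⊆ square a δ' :=
  Set.prod_mono (Set.Icc_subset_Icc_right (by linarith)) (Set.Icc_subset_Icc_right (by linarith))

theorem coverNumber_anti {δ δ' : ℝ} (h : δ ≤ δ') {E : Set (ℝ × ℝ)}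
    (hE : ∃ A : Finset (ℝ × ℝ), E ⊆ ⋃ a ∈ A, square a δ) :
    coverNumber δ' E ≤ coverNumber δ E := by
  obtain ⟨A, hA, hcov⟩ := exists_card_eq_coverNumber hE
  rw [← hA]
  exact coverNumber_le_card (hcov.trans (Set.iUnion₂_mono fun a _ => square_mono h))

/-- A limit along all `δ → 0+` follows from estimates along the powers of `1 / 2`. -/
theorem tendsto_log_div_neg_log {N : ℝ → ℕ} {s : ℝ} (hs : 0 ≤ s)
    (hN : ∀ δ δ' : ℝ, 0 < δ → δ ≤ δ' → N δ' ≤ N δ)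
    (hN0 : ∀ δ : ℝ, 0 < δ → 0 < N δ)
    (hlow : ∃ A : ℝ, ∀ᶠ k : ℕ in atTop, A + s * (k * Real.log 2) ≤ Real.log (N ((1 / 2) ^ k)))
    (hup : ∀ ε : ℝ, 0 < ε → ∀ᶠ k : ℕ in atTop,
      Real.log (N ((1 / 2) ^ k)) ≤ (s + ε) * (k * Real.log 2)) :
    Tendsto (fun δ : ℝ => Real.log (N δ) / (-Real.log δ)) (𝓝[>] 0) (𝓝 s) := by
  have hlog2 : 0 < Real.log 2 := Real.log_pos one_lt_two
  have hD : Tendsto (fun δ : ℝ => -Real.log δ) (𝓝[>] 0) atTop :=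
    tendsto_neg_atBot_atTop.comp Real.tendsto_log_nhdsGT_zero
  have hDinv : Tendsto (fun δ : ℝ => (-Real.log δ)⁻¹) (𝓝[>] 0) (𝓝 0) :=
    tendsto_inv_atTop_zero.comp hD
  -- Each small `δ` lies between consecutive powers of `1/2`. The lower estimate uses the coarser
  -- scale `k`, the upper one the finer scale `k + 1`; the discrepancy of at most `log 2` disappears
  -- after division by `-log δ`.
  have hscale : ∀ p : ℕ → Prop, (∀ᶠ k in atTop, p k) → ∀ᶠ δ : ℝ in 𝓝[>] 0, 0 < δ ∧
      0 < -Real.log δ ∧ ∃ k : ℕ, p k ∧ p (k + 1) ∧ (1 / 2 : ℝ) ^ (k + 1) ≤ δ ∧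
      δ ≤ (1 / 2) ^ k ∧ k * Real.log 2 ≤ -Real.log δ ∧ -Real.log δ ≤ (k + 1) * Real.log 2 := by
    intro p hp
    obtain ⟨K, hK⟩ := eventually_atTop.1 hp
    have hpos : (0 : ℝ) < (1 / 2) ^ (K + 1) := by positivity
    filter_upwards [Ioo_mem_nhdsGT hpos, hD.eventually_gt_atTop 0] with δ hδ hlog
    have hδ1 : δ ≤ 1 := hδ.2.le.trans (pow_le_one₀ (by norm_num) (by norm_num))
    obtain ⟨k, hk1, hk2⟩ := exists_nat_pow_near_of_lt_one hδ.1 hδ1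
      (by norm_num : (0 : ℝ) < 1 / 2) (by norm_num)
    have hKk : K + 1 < k + 1 :=
      (pow_lt_pow_iff_right_of_lt_one₀ (by norm_num : (0 : ℝ) < 1 / 2) (by norm_num)).1
        (hk1.trans hδ.2)
    have hpl : ∀ n : ℕ, Real.log ((1 / 2 : ℝ) ^ n) = -(n * Real.log 2) := fun n => by
      rw [Real.log_pow, one_div, Real.log_inv]; ring
    have h1 := Real.log_le_log (by positivity) hk1.le
    have h2 := Real.log_le_log hδ.1 hk2
    rw [hpl] at h1 h2
    push_cast at h1
    exact ⟨hδ.1, hlog, k, hK _ (by lia), hK _ (by lia), hk1.le, hk2, by linarith, by linarith⟩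
  refine tendsto_order.2 ⟨fun s' hs' => ?_, fun s' hs' => ?_⟩
  · obtain ⟨A, hA⟩ := hlow
    have hlim : Tendsto (fun δ : ℝ => s + (A - s * Real.log 2) * (-Real.log δ)⁻¹) (𝓝[>] 0)
        (𝓝 s) := by simpa using (hDinv.const_mul (A - s * Real.log 2)).const_add s
    filter_upwards [hscale _ hA, hlim.eventually (lt_mem_nhds hs')] with δ hδ hlt
    obtain ⟨hδ0, hlog, k, hk, -, -, hk2, -, hk4⟩ := hδ
    refine hlt.trans_le ?_
    rw [le_div_iff₀ hlog, add_mul, mul_assoc, inv_mul_cancel₀ hlog.ne', mul_one]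
    have h1 : (N ((1 / 2) ^ k) : ℝ) ≤ N δ := by exact_mod_cast hN _ _ hδ0 hk2
    have h2 := Real.log_le_log (by exact_mod_cast hN0 _ (by positivity)) h1
    nlinarith [mul_le_mul_of_nonneg_left hk4 hs]
  · set ε := (s' - s) / 2 with hε
    have hε0 : 0 < ε := by linarith
    have hlim : Tendsto (fun δ : ℝ => (s + ε) + (s + ε) * Real.log 2 * (-Real.log δ)⁻¹) (𝓝[>] 0)
        (𝓝 (s + ε)) := by simpa using (hDinv.const_mul ((s + ε) * Real.log 2)).const_add (s + ε)
    filter_upwards [hscale _ (hup ε hε0), hlim.eventually (gt_mem_nhds (by linarith : s + ε < s'))]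
      with δ hδ hlt
    obtain ⟨hδ0, hlog, k, -, hk, hk1, -, hk3, -⟩ := hδ
    refine lt_of_le_of_lt ?_ hlt
    rw [div_le_iff₀ hlog, add_mul, mul_assoc _ (_)⁻¹, inv_mul_cancel₀ hlog.ne', mul_one]
    have h1 : (N δ : ℝ) ≤ N ((1 / 2) ^ (k + 1)) := by exact_mod_cast hN _ _ (by positivity) hk1
    have h2 := Real.log_le_log (by exact_mod_cast hN0 _ hδ0) h1
    push_cast at hk
    nlinarith [mul_le_mul_of_nonneg_left hk3 (by linarith : 0 ≤ s + ε)]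

/-! ### Box dimension from the growth of line sums -/

section
variable {m : ℕ} {b : Fin (m + 1) → ℝ} {L : ℝ}

/-- The box dimension of the graph, from the growth of the stopping line sums. -/
theorem hasBoxDim_graph (hm : 0 < m) (hb : IsProfile b) (hl : IsRatio (len b) L)
    {y : List (Fin m) → Fin (m + 1) → ℝ} (hy : ∀ w, IsProfile (y w))
    {F : C(unitInterval, unitInterval)} (hF : limitSet b y = graph F) {s : ℝ} (hs : 1 ≤ s)
    (hlow : ∃ a : ℝ, 0 < a ∧ ∀ᶠ k : ℕ in atTop,
      a ≤ line (fun i e => ratio e i * len b i ^ (s - 1)) (len b) L ((1 / 2) ^ k) y)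
    (hup : ∀ j : ℕ, Tendsto (fun k : ℕ => ((1 / 2 : ℝ) ^ (1 / (j + 1) : ℝ)) ^ k *
      line (fun i e => ratio e i * len b i ^ (s - 1)) (len b) L ((1 / 2) ^ k) y) atTop (𝓝 0)) :
    HasBoxDim (graph F) s := by
  have : Nonempty (Fin m) := ⟨⟨0, hm⟩⟩
  obtain ⟨i₀, hi₀⟩ := Finite.exists_min (len b)
  set r := len b i₀ with hr
  have hr0 : 0 < r := hl.apply_pos i₀
  have hr1 : r ≤ 1 := (hl.apply_le i₀).trans hl.lt_one.le
  set Z : ℕ → ℝ := fun k =>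
    line (fun i e => ratio e i * len b i ^ (s - 1)) (len b) L ((1 / 2) ^ k) y with hZ
  have hratio : ∀ (i : Fin m) (e : Fin (m + 1) → ℝ), 0 ≤ ratio e i := fun i e => abs_nonneg _
  have hZ0 : ∀ k, 0 ≤ Z k := fun k => line_nonneg (fun i e =>
    mul_nonneg (hratio i e) (Real.rpow_nonneg (hl.apply_pos i).le _)) _ _
  have hsumlen : ∑ i, len b i = 1 := by
    have := sum_succ_sub_castSucc b
    rw [hb.zero, hb.last, sub_zero] at this
    exact this
  have hgsub : ∀ n, graph F ⊆ levelSet b y n := fun n => by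
    rw [← hF, limitSet_eq]; exact Set.iInter_subset _ n
  have hcover : ∀ δ : ℝ, 0 < δ → ∃ A : Finset (ℝ × ℝ), (A.card : ℝ) ≤
      1 / δ * casc (fun i e => ratio e i) (len b) (fuel L δ) δ y +
        casc (fun _ _ => (1 : ℝ)) (len b) (fuel L δ) δ y ∧ graph F ⊆ ⋃ a ∈ A, square a δ := by
    intro δ hδ
    obtain ⟨A, hA, hcov⟩ := exists_cover_levelSet (h := 1) (u₀ := 0) (v₀ := 0) hb hl hy one_pos
      (pow_fuel_le hl.lt_one hδ)
    simp only [abs_one, one_mul, add_zero, Prod.mk.eta, Set.image_id'] at hA hcov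
    exact ⟨A, hA, (hgsub _).trans hcov⟩
  have hfin : ∀ δ : ℝ, 0 < δ → ∃ A : Finset (ℝ × ℝ), graph F ⊆ ⋃ a ∈ A, square a δ := fun δ hδ =>
    let ⟨A, _, h⟩ := hcover δ hδ
    ⟨A, h⟩
  -- `F` is extended by constants to the whole line, so that the estimates for continuous real
  -- functions apply.
  let f : ℝ → ℝ := fun u => F (Set.projIcc 0 1 zero_le_one u)
  have hf : Continuous f := by
    have : Continuous (Set.projIcc (0 : ℝ) 1 zero_le_one) := continuous_projIcc
    fun_prop
  have hfg : ∀ p ∈ graph F, f p.1 = p.2 := by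
    rintro _ ⟨x, rfl⟩
    simp only [f, Set.projIcc_val]
  have hgf : ∀ t ∈ Set.Icc (0 : ℝ) 1, (t, f t) ∈ graph F := fun t ht =>
    ⟨⟨t, ht⟩, by simp only [f, Set.projIcc_of_mem zero_le_one ht]⟩
  have hcorner : ∀ w, f (affComp b y w (0, 0)).1 = (affComp b y w (0, 0)).2 ∧
      f (affComp b y w (1, 1)).1 = (affComp b y w (1, 1)).2 := by
    intro w
    constructor <;> refine hfg _ ?_ <;> rw [← hF, limitSet_eq] <;> refine Set.mem_iInter.2 fun n => ?_
    · exact affComp_mem_levelSet hb hy (fun y hy n => (corners_mem_levelSet hm hb hy n).1) w n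
    · exact affComp_mem_levelSet hb hy (fun y hy n => (corners_mem_levelSet hm hb hy n).2) w n
  have hδ0 : ∀ k : ℕ, (0 : ℝ) < (1 / 2) ^ k := fun k => by positivity
  have hδ1 : ∀ k : ℕ, (1 / 2 : ℝ) ^ k ≤ 1 := fun k => pow_le_one₀ (by norm_num) (by norm_num)
  have hrδ : ∀ k : ℕ, r * (1 / 2 : ℝ) ^ k ≤ 1 := fun k => mul_le_one₀ hr1 (hδ0 k).le (hδ1 k)
  have hsplit : ∀ δ : ℝ, 0 < δ → δ ^ s = δ ^ (s - 1) * δ := fun δ hδ => by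
    rw [Real.rpow_sub_one hδ.ne', div_mul_cancel₀ _ hδ.ne']
  have hNlow : ∀ k : ℕ, r / 3 * Z k ≤ ((1 / 2 : ℝ) ^ k) ^ s * coverNumber ((1 / 2) ^ k) (graph F) := by
    intro k
    set δ : ℝ := (1 / 2) ^ k with hδ
    obtain ⟨A, hA, hcov⟩ := exists_card_eq_coverNumber (hfin δ (hδ0 k))
    have h1 := mul_casc_le_card (A := A) (δ := δ) hb hl hr0 hi₀ hf (hδ0 k) (hrδ k)
      (fun t ht => by simpa only [Set.mem_iUnion, exists_prop] using hcov (hgf t ht)) (pow_fuel_le hl.lt_one (hδ0 k))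
      (fun w => (hcorner w).1) (fun w => (hcorner w).2)
    have h2 := casc_mul_rpow_le hl hratio (sub_nonneg.2 hs) (pow_fuel_le hl.lt_one (hδ0 k)) y
    rw [hA] at h1
    rw [hsplit δ (hδ0 k)]
    calc r / 3 * Z k ≤ r / 3 * (δ ^ (s - 1) *
          casc (fun i e => ratio e i) (len b) (fuel L δ) δ y) := by gcongr; exact h2
      _ = δ ^ (s - 1) / 3 * (r * casc (fun i e => ratio e i) (len b) (fuel L δ) δ y) := by ring
      _ ≤ δ ^ (s - 1) / 3 * (3 * δ * coverNumber δ (graph F)) := by gcongr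
      _ = _ := by ring
  have hNup : ∀ k : ℕ, ((1 / 2 : ℝ) ^ k) ^ s * coverNumber ((1 / 2) ^ k) (graph F) ≤
      (r ^ (s - 1))⁻¹ * Z k + r⁻¹ := by
    intro k
    set δ : ℝ := (1 / 2) ^ k with hδ
    obtain ⟨A, hA, hcov⟩ := hcover δ (hδ0 k)
    have h1 : (coverNumber δ (graph F) : ℝ) ≤ A.card := by exact_mod_cast coverNumber_le_card hcov
    have h2 := casc_mul_rpow_ge hl.apply_pos hratio (sub_nonneg.2 hs) hr0 hi₀ (fuel L δ) (hδ0 k)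
      (hrδ k) y
    have h3 := casc_one_mul_le hl.apply_pos hsumlen hr0 hi₀ (fuel L δ) (hδ0 k) (hrδ k) y
    rw [Real.mul_rpow hr0.le (hδ0 k).le] at h2
    have h4 := hsplit δ (hδ0 k)
    -- Here `s ≥ 1` enters: the one extra square per stopped rectangle contributes at most `1/r` to
    -- `δ^s N_δ`.
    have hds : δ ^ s ≤ δ := by
      rw [h4]
      exact mul_le_of_le_one_left (hδ0 k).le
        (Real.rpow_le_one (hδ0 k).le (hδ1 k) (sub_nonneg.2 hs))
    have hc1 : 0 ≤ casc (fun (_ : Fin m) (_ : Fin (m + 1) → ℝ) => (1 : ℝ)) (len b) (fuel L δ) δ y :=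
      casc_nonneg _ _ (fun _ _ => zero_le_one) _ _ _
    have hrs : 0 < r ^ (s - 1) := Real.rpow_pos_of_pos hr0 _
    have hδk := hδ0 k
    rw [← hδ] at hδk
    calc δ ^ s * coverNumber δ (graph F) ≤ δ ^ s *
          (1 / δ * casc (fun i e => ratio e i) (len b) (fuel L δ) δ y +
          casc (fun _ _ => (1 : ℝ)) (len b) (fuel L δ) δ y) := by gcongr; exact h1.trans hA
      _ = (r ^ (s - 1))⁻¹ * (casc (fun i e => ratio e i) (len b) (fuel L δ) δ y *
            (r ^ (s - 1) * δ ^ (s - 1))) +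
          δ ^ s * casc (fun _ _ => (1 : ℝ)) (len b) (fuel L δ) δ y := by
            rw [h4]; field_simp
      _ ≤ (r ^ (s - 1))⁻¹ * Z k +
          δ * casc (fun _ _ => (1 : ℝ)) (len b) (fuel L δ) δ y := by gcongr; exact h2
      _ = (r ^ (s - 1))⁻¹ * Z k +
          r⁻¹ * (casc (fun _ _ => (1 : ℝ)) (len b) (fuel L δ) δ y * (r * δ)) := by field_simp
      _ ≤ (r ^ (s - 1))⁻¹ * Z k + r⁻¹ * 1 := by gcongr
      _ = _ := by rw [mul_one]
  have hN0 : ∀ δ : ℝ, 0 < δ → 0 < coverNumber δ (graph F) := by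
    intro δ hδ
    obtain ⟨A, hA, hcov⟩ := exists_card_eq_coverNumber (hfin δ hδ)
    rw [← hA, Finset.card_pos]
    have := hcov (hgf 0 (by simp))
    simp only [Set.mem_iUnion] at this
    obtain ⟨a, ha, -⟩ := this
    exact ⟨a, ha⟩
  have hlog2 : 0 < Real.log 2 := Real.log_pos one_lt_two
  have hlogs : ∀ k : ℕ, Real.log (((1 / 2 : ℝ) ^ k) ^ s * coverNumber ((1 / 2) ^ k) (graph F)) =
      -(s * (k * Real.log 2)) + Real.log (coverNumber ((1 / 2) ^ k) (graph F)) := by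
    intro k
    rw [Real.log_mul (Real.rpow_pos_of_pos (hδ0 k) s).ne'
      (by exact_mod_cast (hN0 _ (hδ0 k)).ne'), Real.log_rpow (hδ0 k), Real.log_pow, one_div,
      Real.log_inv]
    ring
  refine ⟨?_, tendsto_log_div_neg_log (zero_le_one.trans hs)
    (fun δ δ' hδ h => coverNumber_anti h (hfin δ hδ)) hN0 ?_ ?_⟩
  · refine (isCompact_levelSet y 0).isBounded.subset (hgsub 0)
  · obtain ⟨a, ha, hev⟩ := hlow
    refine ⟨Real.log (r / 3 * a), ?_⟩
    filter_upwards [hev] with k hk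
    have h1 : r / 3 * a ≤ _ := (mul_le_mul_of_nonneg_left hk (by positivity)).trans (hNlow k)
    have h2 := Real.log_le_log (by positivity) h1
    rw [hlogs] at h2
    linarith
  · intro ε hε
    -- Half of `ε` pays for the growth of the line sums, the other half for the constant `C`.
    obtain ⟨j, hj⟩ := exists_nat_one_div_lt (half_pos hε)
    set C := (r ^ (s - 1))⁻¹ + r⁻¹ with hC
    have hrs : 0 < r ^ (s - 1) := Real.rpow_pos_of_pos hr0 _
    have hC0 : 0 < C := by positivity
    have hlarge : Tendsto (fun k : ℕ => ε / 2 * (k * Real.log 2)) atTop atTop :=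
      (tendsto_natCast_atTop_atTop.atTop_mul_const hlog2).const_mul_atTop (half_pos hε)
    filter_upwards [(hup j).eventually (gt_mem_nhds zero_lt_one),
      hlarge.eventually_ge_atTop (Real.log C)] with k hk hkC
    set q : ℝ := ((1 / 2 : ℝ) ^ (1 / (j + 1) : ℝ)) ^ k with hq
    have hq0 : 0 < q := by positivity
    have hq1 : q ≤ 1 := pow_le_one₀ (by positivity)
      (Real.rpow_le_one (by norm_num) (by norm_num) (by positivity))
    have hZq : Z k ≤ q⁻¹ := by
      rw [← one_div, le_div_iff₀ hq0, mul_comm]; exact hk.le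
    have h1 : ((1 / 2 : ℝ) ^ k) ^ s * coverNumber ((1 / 2) ^ k) (graph F) ≤ C * q⁻¹ := by
      refine (hNup k).trans ?_
      rw [hC, add_mul]
      gcongr
      exact le_mul_of_one_le_right (by positivity) ((one_le_inv₀ hq0).2 hq1)
    have h2 := Real.log_le_log (mul_pos (Real.rpow_pos_of_pos (hδ0 k) s)
      (by exact_mod_cast hN0 _ (hδ0 k))) h1
    have hlq : Real.log q = -(1 / (j + 1) * (k * Real.log 2)) := by
      rw [hq, Real.log_pow, Real.log_rpow (by norm_num), one_div (2 : ℝ), Real.log_inv]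
      ring
    rw [hlogs, Real.log_mul hC0.ne' (inv_pos.2 hq0).ne', Real.log_inv, hlq] at h2
    have h3 := mul_le_mul_of_nonneg_right hj.le (mul_nonneg (Nat.cast_nonneg (α := ℝ) k) hlog2.le)
    linarith

end

/-! ### The equation for the dimension -/

theorem strictAnti_sum_rpow {ι : Type*} [Fintype ι] {α l : ι → ℝ} (hα : ∀ i, 0 ≤ α i)
    (hl0 : ∀ i, 0 < l i) (hl1 : ∀ i, l i < 1) (hpos : 0 < ∑ i, α i) :
    StrictAnti fun s : ℝ => ∑ i, α i * l i ^ (s - 1) := by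
  intro s s' h
  obtain ⟨i, -, hi⟩ := Finset.exists_lt_of_sum_lt (s := Finset.univ) (f := fun _ : ι => (0 : ℝ))
    (g := α) (by simpa using hpos)
  refine Finset.sum_lt_sum (fun j _ => mul_le_mul_of_nonneg_left ?_ (hα j))
    ⟨i, Finset.mem_univ i, mul_lt_mul_of_pos_left ?_ hi⟩
  · exact Real.rpow_le_rpow_of_exponent_ge (hl0 j) (hl1 j).le (by linarith)
  · exact Real.rpow_lt_rpow_of_exponent_gt (hl0 i) (hl1 i) (by linarith)

/-- The sum is strictly decreasing in `s`, equals `∑ α i ≥ 1` at `s = 1`, and is at most `∑ l i = 1`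
at `s = 2`. -/
theorem existsUnique_sum_rpow_eq_one {ι : Type*} [Fintype ι] {α l : ι → ℝ} (hα : ∀ i, 0 ≤ α i)
    (hα1 : ∀ i, α i ≤ 1) (hl0 : ∀ i, 0 < l i) (hl1 : ∀ i, l i < 1) (hsum : 1 ≤ ∑ i, α i)
    (hl : ∑ i, l i = 1) :
    (∃! s : ℝ, 1 = ∑ i, α i * l i ^ (s - 1)) ∧
      ∀ s : ℝ, 1 = ∑ i, α i * l i ^ (s - 1) → 1 ≤ s := by
  have hanti := strictAnti_sum_rpow hα hl0 hl1 (zero_lt_one.trans_le hsum)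
  have hcont : Continuous fun s : ℝ => ∑ i, α i * l i ^ (s - 1) :=
    continuous_finsetSum _ fun i _ => continuous_const.mul
      ((Real.continuous_const_rpow (hl0 i).ne').comp (continuous_id.sub continuous_const))
  have hone : (fun s : ℝ => ∑ i, α i * l i ^ (s - 1)) 1 = ∑ i, α i := by simp
  have htwo : (fun s : ℝ => ∑ i, α i * l i ^ (s - 1)) 2 ≤ 1 := by
    norm_num
    rw [← hl]
    exact Finset.sum_le_sum fun i _ => mul_le_of_le_one_left (hl0 i).le (hα1 i)
  refine ⟨?_, fun s hs => ?_⟩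
  · obtain ⟨s, -, hs⟩ := intermediate_value_Icc' one_le_two hcont.continuousOn
      ⟨htwo, hsum.trans_eq hone.symm⟩
    exact ⟨s, hs.symm, fun s' hs' => hanti.injective (hs'.symm.trans hs.symm)⟩
  · by_contra! h
    have := hanti h
    rw [hone] at this
    simp only [← hs] at this
    linarith

/-! ### Strict inequalities for powers of the weights -/

section
variable {E : Type*} [MeasurableSpace E] {m : ℕ} {μ : Measure E} [IsProbabilityMeasure μ]
  {c : Fin m → E → ℝ}

theorem IsWeight.integrable_pow (hc : IsWeight c) (i : Fin m) (p : ℕ) :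
    Integrable (fun e => c i e ^ p) μ :=
  integrable_of_abs_le ((hc.measurable i).pow_const p) (K := 1) fun e => by
    rw [abs_pow]; exact pow_le_one₀ (abs_nonneg _) (hc.abs_le i e)

theorem IsWeight.integrable (hc : IsWeight c) (i : Fin m) : Integrable (c i) μ := by
  simpa using hc.integrable_pow (μ := μ) i 1

/-- Equality would give `c i ^ 2 = c i` almost everywhere; as `c i < 1`, every weight would vanish,
against total mean one. -/
theorem IsWeight.sum_integral_sq_lt_one (hc : IsWeight c) (hlt : ∀ᵐ e ∂μ, ∀ i, c i e < 1)
    (hsum : ∑ i, ∫ e, c i e ∂μ = 1) : ∑ i, ∫ e, c i e ^ 2 ∂μ < 1 := by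
  have hle : ∀ i e, c i e ^ 2 ≤ c i e := fun i e => by
    rw [sq]; exact mul_le_of_le_one_left (hc.nonneg i e) (hc.le_one i e)
  have hle' : ∀ i, ∫ e, c i e ^ 2 ∂μ ≤ ∫ e, c i e ∂μ := fun i =>
    integral_mono (hc.integrable_pow i 2) (hc.integrable i) (hle i)
  by_contra! hcon
  have hall : ∀ i ∈ Finset.univ, ∫ e, c i e ^ 2 ∂μ = ∫ e, c i e ∂μ :=
    (Finset.sum_eq_sum_iff_of_le fun i _ => hle' i).1
      (le_antisymm (Finset.sum_le_sum fun i _ => hle' i) (hsum ▸ hcon))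
  have hzero : ∀ i, ∫ e, c i e ∂μ = 0 := by
    intro i
    have h1 : ∫ e, (c i e - c i e ^ 2) ∂μ = 0 := by
      rw [integral_sub (hc.integrable i) (hc.integrable_pow i 2), hall i (Finset.mem_univ i),
        sub_self]
    rw [integral_eq_zero_iff_of_nonneg (fun e => sub_nonneg.2 (hle i e))
      ((hc.integrable i).sub (hc.integrable_pow i 2))] at h1
    refine integral_eq_zero_of_ae ?_
    filter_upwards [h1, hlt] with e he hlt
    have h2 : c i e * (1 - c i e) = 0 := by
      have : c i e - c i e ^ 2 = 0 := he
      rw [← this]; ring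
    rcases mul_eq_zero.1 h2 with h | h
    · exact h
    · linarith [hlt i]
  simp [hzero] at hsum

/-- The powers tend to zero almost everywhere and are dominated by one. Such an exponent makes the
heights of the rectangles tend to zero. -/
theorem IsWeight.exists_pow_sum_integral_lt_one (hc : IsWeight c)
    (hlt : ∀ᵐ e ∂μ, ∀ i, c i e < 1) : ∃ p : ℕ, p ≠ 0 ∧ ∑ i, ∫ e, c i e ^ p ∂μ < 1 := by
  have hlim : Tendsto (fun p : ℕ => ∑ i, ∫ e, c i e ^ p ∂μ) atTop
      (𝓝 (∑ _i : Fin m, ∫ _e : E, (0 : ℝ) ∂μ)) := by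
    refine tendsto_finsetSum _ fun i _ => ?_
    refine tendsto_integral_of_dominated_convergence (fun _ => 1)
      (fun p => (hc.integrable_pow i p).aestronglyMeasurable) (integrable_const _)
      (fun p => ae_of_all _ fun e => ?_) ?_
    · rw [Real.norm_eq_abs, abs_pow]; exact pow_le_one₀ (abs_nonneg _) (hc.abs_le i e)
    · filter_upwards [hlt] with e he
      exact tendsto_pow_atTop_nhds_zero_of_lt_one (hc.nonneg i e) (he i)
  simp only [integral_zero, Finset.sum_const_zero] at hlim
  obtain ⟨p, hp, hp0⟩ := ((hlim.eventually (gt_mem_nhds zero_lt_one)).and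
    (eventually_ne_atTop 0)).exists
  exact ⟨p, hp0, hp⟩

/-- By continuity the strict inequality at `κ = 0` survives for small `κ > 0`, which is the decay
rate in `integral_sq_casc_sub_le`. -/
theorem exists_pos_sum_div_rpow_le_one {β l : Fin m → ℝ} (hl0 : ∀ i, 0 < l i)
    (hβ : ∑ i, β i < 1) : ∃ κ : ℝ, 0 < κ ∧ ∑ i, β i / l i ^ κ ≤ 1 := by
  have hcont : Continuous fun κ : ℝ => ∑ i, β i / l i ^ κ :=
    continuous_finsetSum _ fun i _ => continuous_const.div
      (Real.continuous_const_rpow (hl0 i).ne')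
      fun κ => (Real.rpow_pos_of_pos (hl0 i) κ).ne'
  have hlim : Tendsto (fun κ : ℝ => ∑ i, β i / l i ^ κ) (𝓝[>] 0) (𝓝 (∑ i, β i)) := by
    simpa using (hcont.tendsto 0).mono_left nhdsWithin_le_nhds
  obtain ⟨κ, hκ, hκ0⟩ := ((hlim.eventually (gt_mem_nhds hβ)).and self_mem_nhdsWithin).exists
  exact ⟨κ, hκ0, hκ.le⟩

theorem ae_tree_forall {p : E → Prop} (h : ∀ᵐ e ∂μ, p e) :
    ∀ᵐ y ∂(treeMeasure m μ), ∀ w, p (y w) :=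
  ae_all_iff.2 fun w =>
    (measurePreserving_eval_infinitePi (fun _ : List (Fin m) => μ) w).quasiMeasurePreserving.ae h

end

/-! ### From the random profiles to the theorem -/

section
variable {m : ℕ}

/-- As `m ≥ 2`, one of the indices of two consecutive values is interior, and that value lies
strictly between `0` and `1`. The lemma also applies to the partition itself. -/
theorem ratio_lt_one (hm : 2 ≤ m) {y : Fin (m + 1) → ℝ} (hy : IsProfile y)
    (hin : ∀ j : Fin (m + 1), j ≠ 0 → j ≠ Fin.last m → ¬(y j = 0 ∨ y j = 1)) (i : Fin m) :
    ratio y i < 1 := by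
  have hmem : ∀ j : Fin (m + 1), j ≠ 0 → j ≠ Fin.last m → 0 < y j ∧ y j < 1 := fun j h0 h1 => by
    have := hin j h0 h1
    rw [not_or] at this
    exact ⟨lt_of_le_of_ne (hy.mem j).1 (Ne.symm this.1), lt_of_le_of_ne (hy.mem j).2 this.2⟩
  have h0 := hy.mem i.castSucc
  have h1 := hy.mem i.succ
  rw [ratio, abs_lt]
  by_cases hi : i.castSucc = 0
  · have hlast : i.succ ≠ Fin.last m := fun h => by
      have h2 := congrArg Fin.val h
      have h3 := congrArg Fin.val hi
      simp at h2 h3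
      lia
    have := hmem i.succ (Fin.succ_ne_zero i) hlast
    constructor <;> linarith [h0.1, h0.2]
  · have := hmem i.castSucc hi (Fin.castSucc_lt_last i).ne
    constructor <;> linarith [h1.1, h1.2]

theorem one_le_sum_ratio {y : Fin (m + 1) → ℝ} (hy : IsProfile y) : 1 ≤ ∑ i, ratio y i := by
  have := sum_succ_sub_castSucc y
  rw [hy.last, hy.zero, sub_zero] at this
  rw [← this]
  exact Finset.sum_le_sum fun i _ => le_abs_self _

/-- The ratios add up to at least one and each is below one. -/
theorem exists_two_ratio_pos {y : Fin (m + 1) → ℝ} (hy : IsProfile y)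
    (hlt : ∀ i, ratio y i < 1) : ∃ i j, i ≠ j ∧ 0 < ratio y i ∧ 0 < ratio y j := by
  have hsum := one_le_sum_ratio hy
  obtain ⟨i, -, hi⟩ := Finset.exists_lt_of_sum_lt (s := Finset.univ)
    (f := fun _ : Fin m => (0 : ℝ)) (g := ratio y) (by simpa using zero_lt_one.trans_le hsum)
  rw [← Finset.add_sum_erase _ _ (Finset.mem_univ i)] at hsum
  obtain ⟨j, hj, hj0⟩ := Finset.exists_lt_of_sum_lt (s := Finset.univ.erase i)
    (f := fun _ : Fin m => (0 : ℝ)) (g := ratio y) (by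
      simp only [Finset.sum_const_zero]; linarith [hlt i])
  exact ⟨i, j, (Finset.ne_of_mem_erase hj).symm, hi, hj0⟩

/-- `IsWeight` demands bounds everywhere, the ratios satisfy them only almost surely. Truncation at
one repairs this and changes nothing almost surely. -/
theorem isWeight_min_ratio_mul {l : Fin m → ℝ} (hl0 : ∀ i, 0 ≤ l i) (hl1 : ∀ i, l i ≤ 1) :
    IsWeight fun (i : Fin m) (e : Fin (m + 1) → ℝ) => min 1 (ratio e i) * l i where
  measurable i := by unfold ratio; fun_prop
  nonneg i e := mul_nonneg (le_min zero_le_one (abs_nonneg _)) (hl0 i)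
  le_one i e := mul_le_one₀ (min_le_left _ _) (hl0 i) (hl1 i)

variable {b : Fin (m + 1) → ℝ}

theorem isProfile_partition (hb : StrictMono b) (hb0 : b 0 = 0) (hb1 : b (Fin.last m) = 1) :
    IsProfile b :=
  ⟨hb0, hb1, fun j => ⟨hb0 ▸ hb.monotone (Fin.zero_le j), hb1 ▸ hb.monotone (Fin.le_last j)⟩⟩

theorem exists_isRatio_len (hm : 2 ≤ m) (hb : StrictMono b) (hp : IsProfile b) :
    ∃ L, IsRatio (len b) L := by
  have : Nonempty (Fin m) := ⟨⟨0, by lia⟩⟩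
  obtain ⟨i₀, hi₀⟩ := Finite.exists_max (len b)
  have hpos : ∀ i, 0 < len b i := fun i => sub_pos.2 (hb Fin.castSucc_lt_succ)
  refine ⟨len b i₀, hpos i₀, ?_, hpos, hi₀⟩
  have := ratio_lt_one hm hp (fun j h0 h1 => by
    rw [← hp.zero, ← hp.last, hb.injective.eq_iff, hb.injective.eq_iff]
    exact not_or.2 ⟨h0, h1⟩) i₀
  exact (le_abs_self _).trans_lt this

/-- The theorem for the tree of independent vectors with law `μ`. -/
theorem ae_hasBoxDim {μ : Measure (Fin (m + 1) → ℝ)} [IsProbabilityMeasure μ] (hm : 2 ≤ m)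
    (hb : StrictMono b) (hp : IsProfile b) (hμ : ∀ᵐ e ∂μ, IsProfile e)
    (hμ1 : ∀ᵐ e ∂μ, ∀ i, ratio e i < 1) {s : ℝ} (hs : 1 ≤ s)
    (hsum : ∑ i, (∫ e, min 1 (ratio e i) ∂μ) * len b i ^ (s - 1) = 1) :
    ∀ᵐ y ∂(treeMeasure m μ), ∃ F : C(unitInterval, unitInterval),
      limitSet b y = graph F ∧ HasBoxDim (graph F) s := by
  obtain ⟨L, hl⟩ := exists_isRatio_len hm hb hp
  have hlp0 : ∀ i, 0 < len b i ^ (s - 1) := fun i => Real.rpow_pos_of_pos (hl.apply_pos i) _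
  have hlp1 : ∀ i, len b i ^ (s - 1) ≤ 1 := fun i =>
    Real.rpow_le_one (hl.apply_pos i).le ((hl.apply_le i).trans hl.lt_one.le) (sub_nonneg.2 hs)
  set c : Fin m → (Fin (m + 1) → ℝ) → ℝ := fun i e => min 1 (ratio e i) * len b i ^ (s - 1) with hcdef
  have hc : IsWeight c := isWeight_min_ratio_mul (fun i => (hlp0 i).le) hlp1
  have hcsum : ∑ i, ∫ e, c i e ∂μ = 1 := by
    simp only [hcdef, integral_mul_const]
    exact hsum
  have hmin : ∀ e : Fin (m + 1) → ℝ, (∀ i, ratio e i < 1) → ∀ i, min 1 (ratio e i) = ratio e i :=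
    fun e he i => min_eq_right (he i).le
  have hclt : ∀ᵐ e ∂μ, ∀ i, c i e < 1 := by
    filter_upwards [hμ1] with e he i
    simp only [hcdef, hmin e he i]
    exact (mul_le_of_le_one_right (abs_nonneg _) (hlp1 i)).trans_lt (he i)
  have hsq1 := hc.sum_integral_sq_lt_one hclt hcsum
  obtain ⟨κ, hκ, hsq⟩ := exists_pos_sum_div_rpow_le_one hl.apply_pos hsq1
  have htwo : ∀ᵐ e ∂μ, ∃ i j, i ≠ j ∧ 0 < c i e ∧ 0 < c j e := by
    filter_upwards [hμ, hμ1] with e he he1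
    obtain ⟨i, j, hij, hi, hj⟩ := exists_two_ratio_pos he he1
    refine ⟨i, j, hij, ?_, ?_⟩
    · simp only [hcdef, hmin e he1]; exact mul_pos hi (hlp0 i)
    · simp only [hcdef, hmin e he1]; exact mul_pos hj (hlp0 j)
  have hw1 : IsWeight fun (i : Fin m) (e : Fin (m + 1) → ℝ) => min 1 (ratio e i) * 1 :=
    isWeight_min_ratio_mul (fun _ => zero_le_one) (fun _ => le_rfl)
  obtain ⟨p, hp0, hpsum⟩ := hw1.exists_pow_sum_integral_lt_one (μ := μ) (by
    filter_upwards [hμ1] with e he i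
    rw [hmin e he i, mul_one]; exact he i)
  have hwp : IsWeight fun (i : Fin m) (e : Fin (m + 1) → ℝ) => (min 1 (ratio e i) * 1) ^ p :=
    ⟨fun i => (hw1.measurable i).pow_const p, fun i e => pow_nonneg (hw1.nonneg i e) p,
      fun i e => pow_le_one₀ (hw1.nonneg i e) (hw1.le_one i e)⟩
  filter_upwards [ae_tree_forall hμ, ae_tree_forall hμ1,
    ae_line_ge hl hc hcsum hκ hsq1 hsq htwo,
    ae_all_iff.2 fun j : ℕ => ae_tendsto_rpow_mul_line (l := len b) (L := L) hc hcsum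
      (ε := 1 / (j + 1)) (by positivity),
    ae_tendsto_casc_level (l := len b) hwp hpsum] with y hy hy1 hlow hup hlevel
  -- Once the sum of the `p`-th powers of the heights in a generation is below `ε ^ p`, every height
  -- is below `ε`.
  obtain ⟨F, hF⟩ := exists_limitSet_eq_graph (by lia) hb hp hy (fun ε hε => by
    obtain ⟨n, hn⟩ := (hlevel.eventually (gt_mem_nhds (pow_pos hε p))).exists
    refine ⟨n, ?_⟩
    rintro w rfl
    rw [casc_congr (c' := fun i e => ratio e i ^ p)
      fun w i => by rw [hmin _ (hy1 w) i, mul_one]] at hn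
    exact (lt_of_pow_lt_pow_left₀ p hε.le
      ((wordHeight_pow_le_casc y (len b) p w).trans_lt hn)).le)
  have hline : ∀ x, line c (len b) L x y =
      line (fun i e => ratio e i * len b i ^ (s - 1)) (len b) L x y := fun x =>
    casc_congr (fun w i => by simp only [hcdef, hmin _ (hy1 w) i]) _ _
  simp only [hline] at hlow hup
  exact ⟨F, hF, hasBoxDim_graph (by lia) hp hl hy hF hs hlow hup⟩

end

end RandomSelfAffine

theorem theorem2p4 {Θ : Type*} [MeasurableSpace Θ] (P : Measure Θ) [IsProbabilityMeasure P]
    (m : ℕ) (hm : 2 ≤ m)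
    -- the partition `0 = b_0 < b_1 < ⋯ < b_m = 1`
    (b : Fin (m + 1) → ℝ) (hb : StrictMono b) (hb0 : b 0 = 0) (hb1 : b (Fin.last m) = 1)
    -- the random vectors `Y ω = (y_{ω0}, y_{ω1}, …, y_{ωm})`, with `y_{ω0} = 0`, `y_{ωm} = 1`
    (Y : List (Fin m) → Θ → Fin (m + 1) → ℝ)
    (hY : ∀ ω, Measurable (Y ω))
    (hY0 : ∀ ω θ, Y ω θ 0 = 0) (hY1 : ∀ ω θ, Y ω θ (Fin.last m) = 1)
    (hindep : iIndepFun Y P)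
    (hident : ∀ ω, IdentDistrib (Y ω) (Y []) P P)
    (hrange : ∀ᵐ θ ∂P, ∀ j, Y [] θ j ∈ Set.Icc (0 : ℝ) 1)
    (hnondeg : ∀ j : Fin (m + 1), j ≠ 0 → j ≠ Fin.last m →
      P {θ | Y [] θ j = 0 ∨ Y [] θ j = 1} = 0) :
    (∃! s : ℝ, 1 = ∫ θ, ∑ i : Fin m,
      RandomSelfAffine.ratio (Y [] θ) i * RandomSelfAffine.len b i ^ (s - 1) ∂P) ∧
    ∀ s : ℝ, 1 = ∫ θ, ∑ i : Fin m,
        RandomSelfAffine.ratio (Y [] θ) i * RandomSelfAffine.len b i ^ (s - 1) ∂P →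
      ∀ᵐ θ ∂P, ∃ F : C(unitInterval, unitInterval),
        RandomSelfAffine.limitSet b (fun ω => Y ω θ) = RandomSelfAffine.graph F ∧
        RandomSelfAffine.HasBoxDim (RandomSelfAffine.graph F) s := by
  open RandomSelfAffine in
  set μ := P.map (Y []) with hμdef
  have : IsProbabilityMeasure μ := Measure.isProbabilityMeasure_map (hY []).aemeasurable
  have hp : IsProfile b := isProfile_partition hb hb0 hb1
  obtain ⟨L, hl⟩ := exists_isRatio_len hm hb hp
  have hprof : ∀ᵐ θ ∂P, IsProfile (Y [] θ) := by
    filter_upwards [hrange] with θ hθ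
    exact ⟨hY0 _ _, hY1 _ _, hθ⟩
  have hin : ∀ᵐ θ ∂P, ∀ j : Fin (m + 1), j ≠ 0 → j ≠ Fin.last m →
      ¬(Y [] θ j = 0 ∨ Y [] θ j = 1) := by
    refine ae_all_iff.2 fun j => ?_
    by_cases h : j ≠ 0 ∧ j ≠ Fin.last m
    · have hz : ∀ᵐ θ ∂P, ¬(Y [] θ j = 0 ∨ Y [] θ j = 1) := by
        rw [ae_iff]
        simpa only [not_not] using hnondeg j h.1 h.2
      filter_upwards [hz] with θ hθ _ _ using hθ
    · exact ae_of_all _ fun θ h0 h1 => absurd ⟨h0, h1⟩ h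
  have hlt : ∀ᵐ θ ∂P, ∀ i, ratio (Y [] θ) i < 1 := by
    filter_upwards [hprof, hin] with θ h1 h2 using ratio_lt_one hm h1 h2
  have hrm : ∀ i : Fin m, Measurable fun e : Fin (m + 1) → ℝ => ratio e i := fun i => by
    unfold ratio; fun_prop
  have hw : IsWeight fun (i : Fin m) (e : Fin (m + 1) → ℝ) => min 1 (ratio e i) * 1 :=
    isWeight_min_ratio_mul (fun _ => zero_le_one) (fun _ => le_rfl)
  simp only [mul_one] at hw
  set α : Fin m → ℝ := fun i => ∫ e, min 1 (ratio e i) ∂μ with hα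
  have hμ : ∀ᵐ e ∂μ, IsProfile e := by
    have hms : MeasurableSet {e : Fin (m + 1) → ℝ | IsProfile e} := by
      have : {e : Fin (m + 1) → ℝ | IsProfile e} =
          {e | e 0 = 0} ∩ {e | e (Fin.last m) = 1} ∩ ⋂ j, {e | e j ∈ Set.Icc (0 : ℝ) 1} := by
        ext e
        simp only [Set.mem_ofPred_eq, Set.mem_inter_iff, Set.mem_iInter]
        exact ⟨fun h => ⟨⟨h.zero, h.last⟩, h.mem⟩, fun h => ⟨h.1.1, h.1.2, h.2⟩⟩
      rw [this]
      exact ((measurableSet_eq_fun (measurable_pi_apply _) measurable_const).inter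
        (measurableSet_eq_fun (measurable_pi_apply _) measurable_const)).inter
        (MeasurableSet.iInter fun j => measurable_pi_apply j measurableSet_Icc)
    exact (ae_map_iff (hY []).aemeasurable hms).2 hprof
  have hμ1 : ∀ᵐ e ∂μ, ∀ i, ratio e i < 1 :=
    ae_all_iff.2 fun i => (ae_map_iff (hY []).aemeasurable
      (measurableSet_lt (hrm i) measurable_const)).2 (by filter_upwards [hlt] with θ h using h i)
  have hαint : ∀ i, ∫ θ, ratio (Y [] θ) i ∂P = α i := fun i => by
    simp only [hα, hμdef]
    rw [integral_map (hY []).aemeasurable (hw.measurable i).aestronglyMeasurable]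
    refine integral_congr_ae ?_
    filter_upwards [hlt] with θ h
    exact (min_eq_right (h i).le).symm
  have hrint : ∀ i, Integrable (fun θ => ratio (Y [] θ) i) P := fun i =>
    Integrable.of_bound ((hrm i).comp (hY [])).aestronglyMeasurable 1 (by
      filter_upwards [hlt] with θ h
      rw [Real.norm_eq_abs, ratio, abs_abs]
      exact (h i).le)
  have hfun : ∀ s : ℝ, ∫ θ, ∑ i : Fin m, ratio (Y [] θ) i * len b i ^ (s - 1) ∂P =
      ∑ i, α i * len b i ^ (s - 1) := fun s => by
    rw [integral_finsetSum _ fun i _ => (hrint i).mul_const _]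
    exact Finset.sum_congr rfl fun i _ => by rw [integral_mul_const, hαint]
  have hαsum : 1 ≤ ∑ i, α i := by
    simp_rw [← hαint]
    rw [← integral_finsetSum _ fun i _ => hrint i]
    calc (1 : ℝ) = ∫ _, (1 : ℝ) ∂P := by simp
      _ ≤ _ := integral_mono_ae (integrable_const _) (integrable_finsetSum _ fun i _ => hrint i) (by
        filter_upwards [hprof] with θ h using one_le_sum_ratio h)
  have hlen : ∑ i, len b i = 1 := by
    have := sum_succ_sub_castSucc b
    rw [hb0, hb1, sub_zero] at this
    exact this
  have hα1 : ∀ i, α i ≤ 1 := fun i => by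
    calc α i ≤ ∫ _, (1 : ℝ) ∂μ := integral_mono (hw.integrable i) (integrable_const _) (hw.le_one i)
      _ = 1 := by simp
  have heq := existsUnique_sum_rpow_eq_one (fun i => integral_nonneg (hw.nonneg i)) hα1 hl.apply_pos
    (fun i => (hl.apply_le i).trans_lt hl.lt_one) hαsum hlen
  simp_rw [hfun]
  refine ⟨heq.1, fun s hs => ?_⟩
  -- Independence with equal marginals says that the joint law of `Y` is the product law on the
  -- tree.
  have hmap : P.map (fun θ ω => Y ω θ) = treeMeasure m μ := by
    rw [hindep.map_fun_eq_infinitePi_map hY]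
    congr 1
    funext ω
    exact (hident ω).map_eq
  have key := ae_hasBoxDim hm hb hp hμ hμ1 (heq.2 s hs) hs.symm
  rw [← hmap] at key
  -- Pulling back from the image law requires no measurability of the event.
  exact ae_of_ae_map (measurable_pi_lambda _ hY).aemeasurable key
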